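/- **Setting.** A Kaluza–Klein spacetime is a time-oriented smooth Lorentzian manifold $(M,g)$ of dimension 5 (signature $(-,+,+,+,+)$) with a smooth, free and proper action of the circle $S^1$, whose orbits are spacelike and are the fibres of a Riemannian submersion $\pi:(M,g)\to(B,\bar g)$ onto a 4-dimensional Lorentzian manifold. Let $Y$ be the smooth unit vector field tangent to the fibres (for a choice of orientation of the fibres), and assume that $Y$ is Killing: $\nabla_iY_j+\nabla_jY_i=0$. Put $F=d(Y^\flat)$, let ${}^eF$ be the endomorphism with $g({}^eF(V),W)=F(V,W)$, let $H=Y^\perp$ with orthogonal projection $pr_H$, and let $G=\mathrm{Ric}-\tfrac12 S\,g$ be the Einstein curvature, with associated endomorphism ${}^eG$; $S$ is the scalar curvature, and $\nabla\cdot$ denotes divergence, for a 2-form $(\nabla\cdot F)(V)=\sum_i\epsilon_i(\nabla_{E_i}F)(E_i,V)$ in an orthonormal frame $(E_i)$, $\epsilon_i=g(E_i,E_i)$. Vectors are identified with covectors by $g$. An open set $\Omega\subset M$ is a charged dust domain if on $\Omega$ $$G=\mu\,X\otimes X+\alpha\,Y\otimes Y$$ with smooth functions $\mu>0$ and $\alpha$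 and a smooth vector field $X$ such that at each point $pr_H(X)$ is timelike and spans the eigenspace of $pr_H\circ{}^eG|_H$ for the eigenvalue $-\mu$. Its associated classical data are $X_0=pr_H(X)$, $e=G(Y,X_0)$ (charge density) and $\gamma=G(Y,Y)$. **Theorem (Dynamics of charged dust).** On a charged dust domain $\Omega$, the classical data are smooth, $g(X_0,X_0)=-1$, $X_0\perp Y$, $X=X_0-\frac e\mu Y$ and $$G=\mu\,X_0\otimes X_0-e\,(X_0\otimes Y+Y\otimes X_0)+\gamma\,Y\otimes Y ,$$ and the following hold. - Conservation laws on $\Omega$: $\nabla\cdot(\mu X_0)=0$, $\nabla\cdot(eX_0)=0$ and $X_0(e/\mu)=0$. - Maxwell equations: $dF=0$ on $M$, and $(\nabla\cdot F)^\sharp=2eX_0-(2\gamma+S)Y$ on $\Omega$. - Free fall: $X=X_0-\frac e\mu Y$ is a geodesic vector field on $\Omega$, that is, $\nabla_XX=0$. - Lorentz law on $\Omega$: $\mu\,\nabla_{X_0}X_0=e\,{}^eF(X_0)$, and $\nabla_{X_0}X_0\perp Y$. -/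

import Mathlib

open scoped Manifold ContDiff

set_option maxSynthPendingDepth 3

noncomputable section

/-! ### Semi-Riemannian geometry in a coordinate domain

`h` is a field of nondegenerate symmetric bilinear forms on the model vector space `E`; all
objects are evaluated at the point `y`. -/

namespace CoordGeom

variable {E : Type*} [NormedAddCommGroup E] [NormedSpace ℝ E]

/-- The Christoffel map `Γ(u, v)` of `h` at `y`, determined by
`2 h(Γ(u, v), w) = ∂_u h(v, w) + ∂_v h(u, w) - ∂_w h(u, v)`. -/
def christoffel (h : E → E →L[ℝ] E →L[ℝ] ℝ) (y : E) : E →L[ℝ] E →L[ℝ] E :=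
  (1 / 2 : ℝ) • (ContinuousLinearMap.compL ℝ E (E →L[ℝ] ℝ) E (h y).inverse) ∘L
    (fderiv ℝ h y + (fderiv ℝ h y).flip
      - (ContinuousLinearMap.flipₗᵢ ℝ E E ℝ : (E →L[ℝ] E →L[ℝ] ℝ) →L[ℝ] (E →L[ℝ] E →L[ℝ] ℝ)) ∘L
          (fderiv ℝ h y).flip)

/-- The covariant derivative `v ↦ ∇_v Z` of the vector field `Z` at `y`. -/
def covDeriv (h : E → E →L[ℝ] E →L[ℝ] ℝ) (Z : E → E) (y : E) : E →L[ℝ] E :=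
  fderiv ℝ Z y + (christoffel h y).flip (Z y)

/-- The curvature `R(u, v) w = ∇_u ∇_v w - ∇_v ∇_u w` at `y`, for constant fields `u`, `v`, `w`. -/
def riemann (h : E → E →L[ℝ] E →L[ℝ] ℝ) (y u v w : E) : E :=
  fderiv ℝ (christoffel h) y u v w - fderiv ℝ (christoffel h) y v u w
    + christoffel h y u (christoffel h y v w) - christoffel h y v (christoffel h y u w)

/-- The endomorphism `u ↦ R(u, v) w`. -/
def riemannEnd (h : E → E →L[ℝ] E →L[ℝ] ℝ) (y v w : E) : E →ₗ[ℝ] E where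
  toFun u := riemann h y u v w
  map_add' a b := by simp only [riemann, map_add, add_apply]; abel
  map_smul' c a := by simp only [riemann, map_smul, smul_apply, RingHom.id_apply]; module

/-- The endomorphism `u ↦ A u` with `h(A u, v) = (∇_u β)(v, w)`, where `β` is a field of bilinear
forms and `(∇_u β)(v, w) = ∂_u β(v, w) - β(Γ(u, v), w) - β(v, Γ(u, w))`. -/
def covDerivFormEnd (h β : E → E →L[ℝ] E →L[ℝ] ℝ) (y w : E) : E →ₗ[ℝ] E where
  toFun u := (h y).inverse
    ((fderiv ℝ β y u).flip w - (β y).flip w ∘L christoffel h y u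
      - (β y).flip (christoffel h y u w))
  map_add' a b := by
    rw [← map_add]; congr 1; ext v
    simp; ring
  map_smul' c a := by
    rw [RingHom.id_apply, ← map_smul]; congr 1; ext v
    simp; ring

variable [FiniteDimensional ℝ E]

/-- The Ricci form `Ric(v, w) = tr (u ↦ R(u, v) w)` at `y`. -/
def ricci (h : E → E →L[ℝ] E →L[ℝ] ℝ) (y : E) : E →L[ℝ] E →L[ℝ] ℝ :=
  LinearMap.toContinuousLinearMap <| (LinearMap.toContinuousLinearMap.toLinearMap :
      (E →ₗ[ℝ] ℝ) →ₗ[ℝ] (E →L[ℝ] ℝ)) ∘ₗ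
    LinearMap.mk₂ ℝ (fun v w => LinearMap.trace ℝ E (riemannEnd h y v w))
      (fun v v' w => by
        rw [← map_add]; congr 1; ext u
        simp only [riemannEnd, riemann, map_add, add_apply, LinearMap.coe_mk, AddHom.coe_mk,
          LinearMap.add_apply]
        abel)
      (fun c v w => by
        rw [← map_smul]; congr 1; ext u
        simp only [riemannEnd, riemann, map_smul, smul_apply, LinearMap.coe_mk, AddHom.coe_mk,
          LinearMap.smul_apply]
        module)
      (fun v w w' => by
        rw [← map_add]; congr 1; ext u
        simp only [riemannEnd, riemann, map_add, LinearMap.coe_mk, AddHom.coe_mk,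
          LinearMap.add_apply]
        abel)
      (fun c v w => by
        rw [← map_smul]; congr 1; ext u
        simp only [riemannEnd, riemann, map_smul, LinearMap.coe_mk, AddHom.coe_mk,
          LinearMap.smul_apply]
        module)

/-- The divergence `w ↦ (∇·β)(w)` at `y` of a field `β` of bilinear forms, contracted in the first
slot: in an orthonormal frame `(∇·β)(w) = ∑ εᵢ (∇_{Eᵢ} β)(Eᵢ, w)`. -/
def divForm (h β : E → E →L[ℝ] E →L[ℝ] ℝ) (y : E) : E →L[ℝ] ℝ :=
  LinearMap.toContinuousLinearMap
    { toFun := fun w => LinearMap.trace ℝ E (covDerivFormEnd h β y w)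
      map_add' := fun w w' => by
        rw [← map_add]; congr 1; ext u
        simp only [covDerivFormEnd, LinearMap.coe_mk, AddHom.coe_mk, LinearMap.add_apply]
        rw [← map_add]; congr 1; ext v
        simp; ring
      map_smul' := fun c w => by
        rw [RingHom.id_apply, ← map_smul]; congr 1; ext u
        simp only [covDerivFormEnd, LinearMap.coe_mk, AddHom.coe_mk, LinearMap.smul_apply]
        rw [← map_smul]; congr 1; ext v
        simp; ring }

/-- The scalar curvature at `y`, the `h`-trace of the Ricci form. -/
def scalar (h : E → E →L[ℝ] E →L[ℝ] ℝ) (y : E) : ℝ :=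
  LinearMap.trace ℝ E ((h y).inverse ∘L ricci h y : E →L[ℝ] E)

end CoordGeom

/-! ### Lorentzian manifolds -/

section Manifold

variable {n : ℕ} {M : Type*} [TopologicalSpace M] [ChartedSpace (EuclideanSpace ℝ (Fin n)) M]

/-- The differential at `x` of the preferred chart around `x`. -/
def toCoord (x : M) : TangentSpace (𝓡 n) x →L[ℝ] EuclideanSpace ℝ (Fin n) :=
  mfderiv (𝓡 n) 𝓘(ℝ, EuclideanSpace ℝ (Fin n)) (extChartAt (𝓡 n) x) x

/-- The differential at `y` of the inverse of the preferred chart around `x`. -/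
def ofCoord (x : M) (y : EuclideanSpace ℝ (Fin n)) :
    EuclideanSpace ℝ (Fin n) →L[ℝ] TangentSpace (𝓡 n) ((extChartAt (𝓡 n) x).symm y) :=
  mfderiv 𝓘(ℝ, EuclideanSpace ℝ (Fin n)) (𝓡 n) (extChartAt (𝓡 n) x).symm y

/-- A vector field read in the preferred chart around `x`. -/
def coordField (V : Π x : M, TangentSpace (𝓡 n) x) (x : M) :
    EuclideanSpace ℝ (Fin n) → EuclideanSpace ℝ (Fin n) :=
  VectorField.mpullback 𝓘(ℝ, EuclideanSpace ℝ (Fin n)) (𝓡 n) (extChartAt (𝓡 n) x).symm V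

/-- A 1-form read in the preferred chart around `x`. -/
def coordOneForm (α : Π x : M, TangentSpace (𝓡 n) x →L[ℝ] ℝ) (x : M)
    (y : EuclideanSpace ℝ (Fin n)) : EuclideanSpace ℝ (Fin n) →L[ℝ] ℝ :=
  (α ((extChartAt (𝓡 n) x).symm y)) ∘L ofCoord x y

/-- A field of bilinear forms read in the preferred chart around `x`. -/
def coordForm (β : Π x : M, TangentSpace (𝓡 n) x →L[ℝ] TangentSpace (𝓡 n) x →L[ℝ] ℝ) (x : M)
    (y : EuclideanSpace ℝ (Fin n)) :
    EuclideanSpace ℝ (Fin n) →L[ℝ] EuclideanSpace ℝ (Fin n) →L[ℝ] ℝ :=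
  (ContinuousLinearMap.precomp ℝ (ofCoord x y)) ∘L
    (β ((extChartAt (𝓡 n) x).symm y)) ∘L ofCoord x y

/-- The exterior derivative of a 1-form: `dα(u, v) = ∂_u α(v) - ∂_v α(u)` in coordinates. -/
def extDerivOne (α : Π x : M, TangentSpace (𝓡 n) x →L[ℝ] ℝ) (x : M) :
    TangentSpace (𝓡 n) x →L[ℝ] TangentSpace (𝓡 n) x →L[ℝ] ℝ :=
  let D := fderiv ℝ (coordOneForm α x) (extChartAt (𝓡 n) x x)
  (ContinuousLinearMap.precomp ℝ (toCoord x)) ∘L (D - D.flip) ∘L toCoord x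

/-- The exterior derivative of a 2-form:
`dβ(u, v, w) = ∂_u β(v, w) - ∂_v β(u, w) + ∂_w β(u, v)` in coordinates. -/
def extDerivTwo (β : Π x : M, TangentSpace (𝓡 n) x →L[ℝ] TangentSpace (𝓡 n) x →L[ℝ] ℝ) (x : M)
    (u v w : TangentSpace (𝓡 n) x) : ℝ :=
  let D := fderiv ℝ (coordForm β x) (extChartAt (𝓡 n) x x)
  D (toCoord x u) (toCoord x v) (toCoord x w) - D (toCoord x v) (toCoord x u) (toCoord x w)
    + D (toCoord x w) (toCoord x u) (toCoord x v)

variable [IsManifold (𝓡 n) ∞ M]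

/-- Smoothness of a vector field on a set. -/
def SmoothFieldOn (V : Π x : M, TangentSpace (𝓡 n) x) (s : Set M) : Prop :=
  ContMDiffOn (𝓡 n) (𝓡 n).tangent ∞ (fun x => (⟨x, V x⟩ : TangentBundle (𝓡 n) M)) s

variable (n M) in
/-- A smooth Lorentzian metric of signature `(-, +, …, +)` on an `n`-dimensional manifold. -/
structure LorentzianMetric where
  inner (x : M) : TangentSpace (𝓡 n) x →L[ℝ] TangentSpace (𝓡 n) x →L[ℝ] ℝ
  symm (x : M) (v w : TangentSpace (𝓡 n) x) : inner x v w = inner x w v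
  lorentzian (x : M) : ∃ b : Module.Basis (Fin n) ℝ (TangentSpace (𝓡 n) x), ∀ i j,
    inner x (b i) (b j) = if i = j then (if (i : ℕ) = 0 then -1 else 1) else 0
  contMDiff : ContMDiff (𝓡 n) ((𝓡 n).prod 𝓘(ℝ, EuclideanSpace ℝ (Fin n) →L[ℝ]
      EuclideanSpace ℝ (Fin n) →L[ℝ] ℝ)) ∞
    (fun x => Bundle.TotalSpace.mk' (EuclideanSpace ℝ (Fin n) →L[ℝ]
      EuclideanSpace ℝ (Fin n) →L[ℝ] ℝ) x (inner x))

lemma isInvertible_toCoord (x : M) : (toCoord (n := n) x).IsInvertible :=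
  isInvertible_mfderiv_extChartAt (mem_extChartAt_source x)

lemma coordField_self (σ : Π x : M, TangentSpace (𝓡 n) x) (x : M) :
    coordField σ x (extChartAt (𝓡 n) x x) = toCoord x (σ x) := by
  have h1 : (ofCoord x (extChartAt (𝓡 n) x x)) =
      ContinuousLinearMap.id ℝ (EuclideanSpace ℝ (Fin n)) := by
    rw [ofCoord, ← mfderivWithin_univ, ← ModelWithCorners.range_eq_univ (𝓡 n)]
    exact mfderivWithin_range_extChartAt_symm
  have h2 : (σ ((extChartAt (𝓡 n) x).symm (extChartAt (𝓡 n) x x)) : EuclideanSpace ℝ (Fin n))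
      = σ x := congrArg (fun z => (σ z : EuclideanSpace ℝ (Fin n))) (extChartAt_to_inv x)
  have h3 : toCoord x (σ x) = (σ x : EuclideanSpace ℝ (Fin n)) := by
    rw [toCoord, mfderiv_extChartAt_self]; rfl
  rw [h3, ← h2]
  change (ofCoord x (extChartAt (𝓡 n) x x)).inverse _ = _
  rw [h1]
  exact congrArg (fun L : EuclideanSpace ℝ (Fin n) →L[ℝ] EuclideanSpace ℝ (Fin n) => L _)
    ContinuousLinearMap.inverse_id

lemma differentiableAt_coordField {σ : Π x : M, TangentSpace (𝓡 n) x} {x : M}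
    (hσ : MDifferentiableAt (𝓡 n) (𝓡 n).tangent (fun x => (⟨x, σ x⟩ : TangentBundle (𝓡 n) M)) x) :
    DifferentiableAt ℝ (coordField σ x) (extChartAt (𝓡 n) x x) := by
  have : IsManifold (𝓡 n) 2 M := inferInstance
  have h := MDifferentiableWithinAt.differentiableWithinAt_mpullbackWithin_vectorField
    (I := 𝓡 n) (s := Set.univ) (V := σ) (x := x) hσ.mdifferentiableWithinAt
  rw [ModelWithCorners.range_eq_univ, Set.preimage_univ, Set.univ_inter,
    VectorField.mpullbackWithin_univ] at h
  exact differentiableWithinAt_univ.1 h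

lemma fderiv_comp_extChartAt_symm {f : M → ℝ} {x : M}
    (hf : MDifferentiableAt (𝓡 n) 𝓘(ℝ, ℝ) f x) :
    DifferentiableAt ℝ (fun y => f ((extChartAt (𝓡 n) x).symm y)) (extChartAt (𝓡 n) x x) ∧
    ∀ v, fderiv ℝ (fun y => f ((extChartAt (𝓡 n) x).symm y)) (extChartAt (𝓡 n) x x)
      (toCoord x v) = mvfderiv (𝓡 n) f x v := by
  have h1 : MDifferentiableAt 𝓘(ℝ, EuclideanSpace ℝ (Fin n)) 𝓘(ℝ, ℝ)
      (fun y => f ((extChartAt (𝓡 n) x).symm y)) (extChartAt (𝓡 n) x x) := by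
    apply MDifferentiableAt.comp (I' := 𝓡 n)
    · rwa [extChartAt_to_inv]
    · have h := mdifferentiableWithinAt_extChartAt_symm (I := 𝓡 n) (mem_extChartAt_target x)
      rwa [ModelWithCorners.range_eq_univ, mdifferentiableWithinAt_univ] at h
  refine ⟨h1.differentiableAt, fun v => ?_⟩
  have h2 : f =ᶠ[nhds x] (fun y => f ((extChartAt (𝓡 n) x).symm y)) ∘ extChartAt (𝓡 n) x := by
    filter_upwards [extChartAt_source_mem_nhds (I := 𝓡 n) x] with z hz
    simp only [Function.comp_apply, (extChartAt (𝓡 n) x).left_inv hz]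
  rw [mvfderiv, h2.mfderiv_eq, mfderiv_comp x h1 (mdifferentiableAt_extChartAt (mem_chart_source _ x))]
  rw [mfderiv_eq_fderiv]
  rfl

/-- The Levi-Civita connection of a Lorentzian metric: `leviCivita g Z x v` is `∇_v Z`. -/
def LorentzianMetric.leviCivita (g : LorentzianMetric n M) :
    CovariantDerivative (𝓡 n) (EuclideanSpace ℝ (Fin n))
      (TangentSpace (𝓡 n) : M → Type _) where
  toFun Z x := (toCoord x).inverse ∘L
    CoordGeom.covDeriv (coordForm g.inner x) (coordField Z x) (extChartAt (𝓡 n) x x) ∘L toCoord x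
  isCovariantDerivativeOnUniv :=
    { add := by
        intro σ σ' x hσ hσ' _
        have h : coordField (σ + σ') x = coordField σ x + coordField σ' x := by
          ext1 y; exact map_add _ _ _
        rw [h]
        ext1 v
        simp only [CoordGeom.covDeriv, ContinuousLinearMap.comp_apply, add_apply]
        rw [fderiv_add (differentiableAt_coordField hσ) (differentiableAt_coordField hσ')]
        simp only [Pi.add_apply, add_apply, map_add]
        abel
      leibniz := by
        intro σ f x hσ hf _
        have h : coordField (f • σ) x = fun y =>
            (f ((extChartAt (𝓡 n) x).symm y)) • coordField σ x y := by
          ext1 y; exact (ofCoord x y).inverse.map_smul _ _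
        obtain ⟨h1, h2⟩ := fderiv_comp_extChartAt_symm hf
        have h3 : (toCoord x).inverse (coordField σ x (extChartAt (𝓡 n) x x)) = σ x := by
          obtain ⟨e, he⟩ := isInvertible_toCoord (n := n) x
          rw [coordField_self, ← he]; simp
        rw [h]
        ext1 v
        simp only [CoordGeom.covDeriv, ContinuousLinearMap.comp_apply, add_apply]
        rw [fderiv_fun_smul h1 (differentiableAt_coordField hσ)]
        simp only [add_apply, smul_apply, ContinuousLinearMap.smulRight_apply, h2, map_add,
          map_smul, h3, ContinuousLinearMap.flip_apply, extChartAt_to_inv,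
          ContinuousLinearMap.comp_apply]
        module }


namespace LorentzianMetric

variable (g : LorentzianMetric n M)

/-- The 1-form `V♭ = g(V, ·)`. -/
def flat (V : Π x : M, TangentSpace (𝓡 n) x) (x : M) : TangentSpace (𝓡 n) x →L[ℝ] ℝ :=
  g.inner x (V x)

/-- The tangent vector `α♯` with `g(α♯, ·) = α`. -/
def sharp (x : M) (α : TangentSpace (𝓡 n) x →L[ℝ] ℝ) : TangentSpace (𝓡 n) x :=
  (g.inner x).inverse α

/-- The endomorphism `ᵉβ` associated with a bilinear form `β`: `g(ᵉβ v, w) = β(v, w)`. -/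
def endo (β : Π x : M, TangentSpace (𝓡 n) x →L[ℝ] TangentSpace (𝓡 n) x →L[ℝ] ℝ) (x : M) :
    TangentSpace (𝓡 n) x →L[ℝ] TangentSpace (𝓡 n) x :=
  (g.inner x).inverse ∘L β x

/-- `∇_V Z`. -/
def nabla (V Z : Π x : M, TangentSpace (𝓡 n) x) (x : M) : TangentSpace (𝓡 n) x :=
  g.leviCivita Z x (V x)

/-- The divergence `∇·Z` of a vector field, the trace of `v ↦ ∇_v Z`. -/
def divergence (Z : Π x : M, TangentSpace (𝓡 n) x) (x : M) : ℝ :=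
  LinearMap.trace ℝ (TangentSpace (𝓡 n) x) (g.leviCivita Z x)

/-- The divergence `∇·β` of a field of bilinear forms, contracted in the first slot. -/
def divForm (β : Π x : M, TangentSpace (𝓡 n) x →L[ℝ] TangentSpace (𝓡 n) x →L[ℝ] ℝ) (x : M) :
    TangentSpace (𝓡 n) x →L[ℝ] ℝ :=
  CoordGeom.divForm (coordForm g.inner x) (coordForm β x) (extChartAt (𝓡 n) x x) ∘L toCoord x

/-- The Ricci curvature. -/
def ricci (x : M) : TangentSpace (𝓡 n) x →L[ℝ] TangentSpace (𝓡 n) x →L[ℝ] ℝ :=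
  (ContinuousLinearMap.precomp ℝ (toCoord x)) ∘L
    CoordGeom.ricci (coordForm g.inner x) (extChartAt (𝓡 n) x x) ∘L toCoord x

/-- The scalar curvature. -/
def scalar (x : M) : ℝ := CoordGeom.scalar (coordForm g.inner x) (extChartAt (𝓡 n) x x)

/-- The Einstein curvature `G = Ric - (S / 2) g`. -/
def einstein (x : M) : TangentSpace (𝓡 n) x →L[ℝ] TangentSpace (𝓡 n) x →L[ℝ] ℝ :=
  g.ricci x - (g.scalar x / 2) • g.inner x

/-- The Killing equation `∇ᵢ Yⱼ + ∇ⱼ Yᵢ = 0`. -/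
def IsKilling (Y : Π x : M, TangentSpace (𝓡 n) x) : Prop :=
  ∀ (x : M) (v w : TangentSpace (𝓡 n) x),
    g.inner x (g.leviCivita Y x v) w + g.inner x v (g.leviCivita Y x w) = 0

end LorentzianMetric

end Manifold

/-! ### Kaluza-Klein spacetimes and charged dust -/

section KaluzaKlein

variable {M : Type*} [TopologicalSpace M] [ChartedSpace (EuclideanSpace ℝ (Fin 5)) M]
  [IsManifold (𝓡 5) ∞ M]
  {B : Type*} [TopologicalSpace B] [ChartedSpace (EuclideanSpace ℝ (Fin 4)) B]
  [IsManifold (𝓡 4) ∞ B]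

variable (M B) in
/-- A Kaluza-Klein spacetime: a time-oriented 5-dimensional Lorentzian manifold `M` with a smooth,
free and proper action of the circle, whose orbits are spacelike and are the fibres of a
Riemannian submersion `π : M → B` onto a 4-dimensional Lorentzian manifold `B`. -/
structure KaluzaKleinSpacetime [MulAction Circle M] where
  /-- the metric of `M` -/
  g : LorentzianMetric 5 M
  /-- the time orientation, given by a timelike vector field -/
  timeField : Π x : M, TangentSpace (𝓡 5) x
  timeField_smooth : SmoothFieldOn timeField Set.univ
  timeField_timelike : ∀ x, g.inner x (timeField x) (timeField x) < 0
  smooth_action : ContMDiffSMul (𝓡 1) (𝓡 5) ∞ Circle M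
  free_action : ∀ (z : Circle) (x : M), z • x = x → z = 1
  proper_action : ProperSMul Circle M
  /-- the projection onto the base -/
  π : M → B
  π_smooth : ContMDiff (𝓡 5) (𝓡 4) ∞ π
  π_surjective : Function.Surjective π
  π_submersion : ∀ x, Function.Surjective (mfderiv (𝓡 5) (𝓡 4) π x)
  π_fiber : ∀ x x', π x = π x' ↔ ∃ z : Circle, z • x = x'
  /-- the metric of `B` -/
  gBase : LorentzianMetric 4 B
  fiber_spacelike : ∀ (x : M) (v : TangentSpace (𝓡 5) x),
    mfderiv (𝓡 5) (𝓡 4) π x v = 0 → v ≠ 0 → 0 < g.inner x v v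
  π_isometric : ∀ (x : M) (v w : TangentSpace (𝓡 5) x),
    (∀ u, mfderiv (𝓡 5) (𝓡 4) π x u = 0 → g.inner x v u = 0) →
    (∀ u, mfderiv (𝓡 5) (𝓡 4) π x u = 0 → g.inner x w u = 0) →
    gBase.inner (π x) (mfderiv (𝓡 5) (𝓡 4) π x v) (mfderiv (𝓡 5) (𝓡 4) π x w) = g.inner x v w

namespace KaluzaKleinSpacetime

variable [MulAction Circle M] (K : KaluzaKleinSpacetime M B)

/-- `Y` is the smooth unit vector field tangent to the fibres, for one of the orientations of the
fibres. -/
structure IsUnitFiberField (Y : Π x : M, TangentSpace (𝓡 5) x) : Prop where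
  smooth : SmoothFieldOn Y Set.univ
  tangent : ∀ x, mfderiv (𝓡 5) (𝓡 4) K.π x (Y x) = 0
  unit : ∀ x, K.g.inner x (Y x) (Y x) = 1

/-- The electromagnetic field `F = d(Y♭)`. -/
def emField (Y : Π x : M, TangentSpace (𝓡 5) x) (x : M) :
    TangentSpace (𝓡 5) x →L[ℝ] TangentSpace (𝓡 5) x →L[ℝ] ℝ :=
  extDerivOne (K.g.flat Y) x

/-- The orthogonal projection `pr_H` onto the horizontal space `H = Y^⊥`, for a unit vector `Y`. -/
def prH (Y : Π x : M, TangentSpace (𝓡 5) x) (x : M) (v : TangentSpace (𝓡 5) x) :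
    TangentSpace (𝓡 5) x :=
  v - K.g.inner x v (Y x) • Y x

/-- `Ω` is a charged dust domain: on the open set `Ω`, `G = μ X ⊗ X + α Y ⊗ Y` (vectors being
identified with covectors by the metric), where at each point `pr_H(X)` is timelike and spans the
eigenspace of `ᵉG_H = pr_H ∘ ᵉG|_H` for the eigenvalue `-μ < 0`. -/
structure IsChargedDust (Y : Π x : M, TangentSpace (𝓡 5) x) (Ω : Set M)
    (μ α : M → ℝ) (X : Π x : M, TangentSpace (𝓡 5) x) : Prop where
  isOpen : IsOpen Ω
  smooth_μ : ContMDiffOn (𝓡 5) 𝓘(ℝ, ℝ) ∞ μ Ω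
  smooth_α : ContMDiffOn (𝓡 5) 𝓘(ℝ, ℝ) ∞ α Ω
  smooth_X : SmoothFieldOn X Ω
  einstein_eq : ∀ x ∈ Ω, ∀ v w, K.g.einstein x v w =
    μ x * (K.g.inner x (X x) v * K.g.inner x (X x) w)
      + α x * (K.g.inner x (Y x) v * K.g.inner x (Y x) w)
  μ_pos : ∀ x ∈ Ω, 0 < μ x
  timelike : ∀ x ∈ Ω, K.g.inner x (K.prH Y x (X x)) (K.prH Y x (X x)) < 0
  eigenspace : ∀ x ∈ Ω, ∀ v, K.g.inner x v (Y x) = 0 →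
    (K.prH Y x (K.g.endo K.g.einstein x v) = (-μ x) • v ↔ ∃ c : ℝ, v = c • K.prH Y x (X x))

/-- The visible field `X₀ = pr_H(X)`. -/
def visibleField (Y X : Π x : M, TangentSpace (𝓡 5) x) (x : M) : TangentSpace (𝓡 5) x :=
  K.prH Y x (X x)

/-- The charge density `e = G(Y, X₀)`. -/
def chargeDensity (Y X : Π x : M, TangentSpace (𝓡 5) x) (x : M) : ℝ :=
  K.g.einstein x (Y x) (K.visibleField Y X x)

/-- The coefficient `γ = G(Y, Y)`. -/
def gammaCoeff (Y : Π x : M, TangentSpace (𝓡 5) x) (x : M) : ℝ :=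
  K.g.einstein x (Y x) (Y x)

end KaluzaKleinSpacetime

end KaluzaKlein

end

/-!
The argument is local and runs in a single chart, for a metric `h` on an open set of a vector space
with a unit Killing field `Y` and the Einstein equation `G = μ X ⊗ X + α Y ⊗ Y`
(`CoordGeom.IsDustOn`). Two facts about the curvature carry it.

* A Killing field satisfies `∇_a ∇Y = R(a, Y)` (`covDerivEnd_killing`). Tracing, the divergence of
  `F = d(Y♭) = 2 g(∇Y, ·)` is `-2 Ric(Y, ·)` (`divForm_killing`), which is the source equation of
  the electromagnetic field once `Ric = G + S g / 2` is inserted. Differentiating once more and using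
  the differential Bianchi identity, the Lie derivative of `Ric`, hence of `G`, along `Y` vanishes
  (`covDerivEnd_ricciEnd_killing`, `fderiv_scalar_killing`).
* The contracted Bianchi identity says that `G` is divergence-free (`div_ricciEnd`).

The eigenvalue `-μ` normalizes `X₀ = X - g(X, Y) Y` to `g(X₀, X₀) = -1`, so that
`g(X, X) = g(X, Y)² - 1`. Contracting `L_Y G = 0` with `X₀` gives `Y(μ) = 0`, `[Y, X] = 0` and
`Y(g(X, Y)) = 0`. As `Y` is divergence-free with geodesic orbits, `div G = 0` becomes
`div(μ X) X + μ ∇_X X = 0`; its components along `Y` and `X`, together with the normalization,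
force `div(μ X) = 0`, `X(g(X, Y)) = 0` and finally `∇_X X = 0` (`IsDustOn.dynamics`).

Everything else is algebra in these equations: `e = -μ g(X, Y)`, so `e / μ` is constant along `X₀`
and both `μ X₀` and `e X₀` are conserved, while
`∇_{X₀} X₀ = -2 g(X, Y) ∇_X Y` (`covDeriv_visible_self`) and the endomorphism of `F` sends `X₀` to
`2 ∇_X Y`, which is the Lorentz law. The curvature and the connection at a point are defined in the
preferred chart of that point; `CoordGeom.IsIsometryOn` expresses that coordinate changes are
isometries, and the naturality of the Christoffel map, of `d`, of `Ric` and of `S` under them allows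
all points of a neighbourhood to be treated in one chart.
-/

noncomputable section

namespace CoordGeom

/-! ### Curvature of a connection in a coordinate domain -/

variable {E : Type*} [NormedAddCommGroup E] [NormedSpace ℝ E]

section Calculus

variable {F G : Type*} [NormedAddCommGroup F] [NormedSpace ℝ F] [NormedAddCommGroup G]
  [NormedSpace ℝ G]

lemma fderiv_clm_apply_apply {c : E → F →L[ℝ] G} {u : E → F} {y : E}
    (hc : DifferentiableAt ℝ c y) (hu : DifferentiableAt ℝ u y) (a : E) :
    fderiv ℝ (fun z => c z (u z)) y a = fderiv ℝ c y a (u y) + c y (fderiv ℝ u y a) := by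
  rw [fderiv_clm_apply hc hu]; simp [add_comm]

lemma fderiv_clm_apply_const {c : E → F →L[ℝ] G} {y : E}
    (hc : DifferentiableAt ℝ c y) (v : F) (a : E) :
    fderiv ℝ (fun z => c z v) y a = fderiv ℝ c y a v := by
  rw [fderiv_clm_apply_apply hc (differentiableAt_const v)]; simp

lemma fderiv_form_apply {β : E → F →L[ℝ] F →L[ℝ] G} {u v : E → F} {y : E}
    (hβ : DifferentiableAt ℝ β y) (hu : DifferentiableAt ℝ u y) (hv : DifferentiableAt ℝ v y)
    (a : E) :
    fderiv ℝ (fun z => β z (u z) (v z)) y a =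
      fderiv ℝ β y a (u y) (v y) + β y (fderiv ℝ u y a) (v y) + β y (u y) (fderiv ℝ v y a) := by
  rw [fderiv_clm_apply_apply (hβ.clm_apply hu) hv, fderiv_clm_apply_apply hβ hu, add_apply]

lemma fderiv_clm_comp_apply {c d : E → E →L[ℝ] E} {y : E}
    (hc : DifferentiableAt ℝ c y) (hd : DifferentiableAt ℝ d y) (a : E) :
    fderiv ℝ (fun z => c z ∘L d z) y a = c y ∘L fderiv ℝ d y a + fderiv ℝ c y a ∘L d y := by
  rw [fderiv_clm_comp hc hd]; ext w; simp

lemma fderiv_eq_of_eqOn {f f' : E → F} {U : Set E} (hU : IsOpen U) (h : ∀ z ∈ U, f z = f' z)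
    {y : E} (hy : y ∈ U) : fderiv ℝ f y = fderiv ℝ f' y :=
  (Filter.eventuallyEq_of_mem (hU.mem_nhds hy) h).fderiv_eq

lemma differentiableAt_of_contDiffOn {f : E → F} {U : Set E} (hU : IsOpen U)
    (hf : ContDiffOn ℝ ∞ f U) {y : E} (hy : y ∈ U) : DifferentiableAt ℝ f y :=
  ((hf y hy).contDiffAt (hU.mem_nhds hy)).differentiableAt (by simp)

lemma contDiffOn_fderiv {f : E → F} {U : Set E} (hU : IsOpen U) (hf : ContDiffOn ℝ ∞ f U) :
    ContDiffOn ℝ ∞ (fderiv ℝ f) U :=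
  hf.fderiv_of_isOpen hU le_rfl

lemma snd_fderiv_symm {f : E → F} {U : Set E} (hU : IsOpen U)
    (hf : ContDiffOn ℝ ∞ f U) {y : E} (hy : y ∈ U) (a b : E) :
    fderiv ℝ (fderiv ℝ f) y a b = fderiv ℝ (fderiv ℝ f) y b a :=
  (((hf y hy).contDiffAt (hU.mem_nhds hy)).isSymmSndFDerivAt
    (by simp only [minSmoothness_of_isRCLikeNormedField]; exact WithTop.coe_le_coe.2 le_top)).eq a b

end Calculus

/-- The curvature `R(a, b) = ∂_a A_b - ∂_b A_a + A_a A_b - A_b A_a` of the connection `∂ + A`,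
with values in the endomorphisms. -/
def curv (A : E → E →L[ℝ] E →L[ℝ] E) (y : E) : E →L[ℝ] E →L[ℝ] E →L[ℝ] E :=
  fderiv ℝ A y - (fderiv ℝ A y).flip + (ContinuousLinearMap.compL ℝ E E E).bilinearComp (A y) (A y)
    - ((ContinuousLinearMap.compL ℝ E E E).bilinearComp (A y) (A y)).flip

lemma curv_apply (A : E → E →L[ℝ] E →L[ℝ] E) (y a b : E) :
    curv A y a b = fderiv ℝ A y a b - fderiv ℝ A y b a + A y a ∘L A y b - A y b ∘L A y a := by
  simp [curv]

lemma curv_antisymm (A : E → E →L[ℝ] E →L[ℝ] E) (y a b : E) :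
    curv A y a b = - curv A y b a := by
  simp only [curv_apply]; abel

lemma riemann_eq_curv (h : E → E →L[ℝ] E →L[ℝ] ℝ) (y u v w : E) :
    riemann h y u v w = curv (christoffel h) y u v w := by
  simp [curv_apply, riemann]

/-- The covariant derivative `∇_a T = ∂_a T + [A_a, T]` of a field of endomorphisms. -/
def covDerivEnd (A : E → E →L[ℝ] E →L[ℝ] E) (T : E → E →L[ℝ] E) (y a : E) : E →L[ℝ] E :=
  fderiv ℝ T y a + A y a ∘L T y - T y ∘L A y a

/-- The derivation induced by an endomorphism `Q` on the trilinear maps `R`: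
`(Q · R)(a, b) = [Q, R(a, b)] - R(Qa, b) - R(a, Qb)`. -/
def derivAct (Q : E →L[ℝ] E) (R : E →L[ℝ] E →L[ℝ] E →L[ℝ] E) : E →L[ℝ] E →L[ℝ] E →L[ℝ] E :=
  (ContinuousLinearMap.compL ℝ E (E →L[ℝ] E) (E →L[ℝ] E) (ContinuousLinearMap.compL ℝ E E E Q)) ∘L R
    - (ContinuousLinearMap.compL ℝ E (E →L[ℝ] E) (E →L[ℝ] E)
        ((ContinuousLinearMap.compL ℝ E E E).flip Q)) ∘L R
    - R ∘L Q - ((ContinuousLinearMap.compL ℝ E E (E →L[ℝ] E)).flip Q) ∘L R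

lemma derivAct_apply (Q : E →L[ℝ] E) (R : E →L[ℝ] E →L[ℝ] E →L[ℝ] E) (a b : E) :
    derivAct Q R a b = Q ∘L R a b - R a b ∘L Q - R (Q a) b - R a (Q b) := by
  simp [derivAct]

/-- The covariant derivative `∇_c R` of the curvature. -/
def covDerivCurv (A : E → E →L[ℝ] E →L[ℝ] E) (y c : E) : E →L[ℝ] E →L[ℝ] E →L[ℝ] E :=
  fderiv ℝ (curv A) y c + derivAct (A y c) (curv A y)

section Connection

variable {A : E → E →L[ℝ] E →L[ℝ] E} {U : Set E}

/-- Covariant derivatives of a field of endomorphisms commute up to the curvature. -/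
lemma covDerivEnd_comm (hU : IsOpen U) (hA : ContDiffOn ℝ ∞ A U) {T : E → E →L[ℝ] E}
    (hT : ContDiffOn ℝ ∞ T U) {y : E} (hy : y ∈ U) (a b : E) :
    covDerivEnd A (fun z => covDerivEnd A T z b) y a
      - covDerivEnd A (fun z => covDerivEnd A T z a) y b
      = curv A y a b ∘L T y - T y ∘L curv A y a b := by
  have key : ∀ a b, fderiv ℝ (fun z => covDerivEnd A T z b) y a =
      fderiv ℝ (fderiv ℝ T) y a b + (A y b ∘L fderiv ℝ T y a + fderiv ℝ A y a b ∘L T y)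
        - (T y ∘L fderiv ℝ A y a b + fderiv ℝ T y a ∘L A y b) := by
    intro a b
    have dT := differentiableAt_of_contDiffOn hU hT hy
    have dT' := differentiableAt_of_contDiffOn hU (contDiffOn_fderiv hU hT) hy
    have dA := differentiableAt_of_contDiffOn hU hA hy
    have dAb : DifferentiableAt ℝ (fun z => A z b) y := dA.clm_apply (differentiableAt_const b)
    have dT'b : DifferentiableAt ℝ (fun z => fderiv ℝ T z b) y :=
      dT'.clm_apply (differentiableAt_const b)
    unfold covDerivEnd
    rw [fderiv_fun_sub (dT'b.fun_add (dAb.clm_comp dT)) (dT.clm_comp dAb),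
      fderiv_fun_add dT'b (dAb.clm_comp dT), sub_apply, add_apply, fderiv_clm_comp_apply dAb dT,
      fderiv_clm_comp_apply dT dAb, fderiv_clm_apply_const dA, fderiv_clm_apply_const dT']
  have e : ∀ S c, covDerivEnd A S y c = fderiv ℝ S y c + A y c ∘L S y - S y ∘L A y c :=
    fun _ _ => rfl
  rw [e (fun z => covDerivEnd A T z b) a, e (fun z => covDerivEnd A T z a) b, key, key, curv_apply,
    snd_fderiv_symm hU hT hy a b]
  simp only [covDerivEnd]
  ext w
  simp only [ContinuousLinearMap.comp_apply, add_apply, sub_apply, map_add, map_sub]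
  abel

/-- The algebraic Bianchi identity, for a connection that is torsion-free on an open set. -/
lemma curv_bianchi (hU : IsOpen U) (hA : ContDiffOn ℝ ∞ A U)
    (hsymm : ∀ z ∈ U, ∀ a b, A z a b = A z b a) {y : E} (hy : y ∈ U) (a b c : E) :
    curv A y a b c + curv A y b c a + curv A y c a b = 0 := by
  have dA := differentiableAt_of_contDiffOn hU hA hy
  have h : ∀ a b c, fderiv ℝ A y a b c = fderiv ℝ A y a c b := by
    intro a b c
    have h1 : ∀ b c, fderiv ℝ (fun z => A z b c) y a = fderiv ℝ A y a b c := fun b c => by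
      rw [fderiv_clm_apply_const (dA.clm_apply (differentiableAt_const b)),
        fderiv_clm_apply_const dA]
    rw [← h1, ← h1, fderiv_eq_of_eqOn hU (fun z hz => hsymm z hz b c) hy]
  simp only [curv_apply, ContinuousLinearMap.comp_apply, add_apply, sub_apply]
  rw [h a b c, h b c a, h c a b, hsymm y hy a b, hsymm y hy b c, hsymm y hy c a]
  abel

variable [FiniteDimensional ℝ E]

lemma contDiffOn_curv (hU : IsOpen U) (hA : ContDiffOn ℝ ∞ A U) : ContDiffOn ℝ ∞ (curv A) U := by
  refine contDiffOn_clm_apply.2 fun a => contDiffOn_clm_apply.2 fun b => ?_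
  simp only [curv_apply]
  have h1 := contDiffOn_fderiv hU hA
  have hc : ∀ a, ContDiffOn ℝ ∞ (fun y => A y a) U := fun a => hA.clm_apply contDiffOn_const
  have h2 : ∀ a b, ContDiffOn ℝ ∞ (fun y => fderiv ℝ A y a b) U := fun a b =>
    (h1.clm_apply contDiffOn_const).clm_apply contDiffOn_const
  exact (((h2 a b).sub (h2 b a)).add ((hc a).clm_comp (hc b))).sub ((hc b).clm_comp (hc a))

lemma fderiv_curv_apply (hU : IsOpen U) (hA : ContDiffOn ℝ ∞ A U) {y : E} (hy : y ∈ U)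
    (c a b : E) : fderiv ℝ (curv A) y c a b = fderiv ℝ (fun z => curv A z a b) y c := by
  have h := differentiableAt_of_contDiffOn hU (contDiffOn_curv hU hA) hy
  rw [fderiv_clm_apply_const (h.clm_apply (differentiableAt_const a)), fderiv_clm_apply_const h]

lemma fderiv_curv (hU : IsOpen U) (hA : ContDiffOn ℝ ∞ A U) {y : E} (hy : y ∈ U) (c a b : E) :
    fderiv ℝ (curv A) y c a b =
      fderiv ℝ (fderiv ℝ A) y c a b - fderiv ℝ (fderiv ℝ A) y c b a
      + (A y a ∘L fderiv ℝ A y c b + fderiv ℝ A y c a ∘L A y b)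
      - (A y b ∘L fderiv ℝ A y c a + fderiv ℝ A y c b ∘L A y a) := by
  rw [fderiv_curv_apply hU hA hy]
  have dA := differentiableAt_of_contDiffOn hU hA hy
  have dA' := differentiableAt_of_contDiffOn hU (contDiffOn_fderiv hU hA) hy
  have d1 : ∀ a, DifferentiableAt ℝ (fun z => A z a) y := fun a =>
    dA.clm_apply (differentiableAt_const a)
  have d2 : ∀ a, DifferentiableAt ℝ (fun z => fderiv ℝ A z a) y := fun a =>
    dA'.clm_apply (differentiableAt_const a)
  have d3 : ∀ a b, DifferentiableAt ℝ (fun z => fderiv ℝ A z a b) y := fun a b =>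
    (d2 a).clm_apply (differentiableAt_const b)
  simp only [curv_apply]
  rw [fderiv_fun_sub (((d3 a b).fun_sub (d3 b a)).fun_add ((d1 a).clm_comp (d1 b)))
      ((d1 b).clm_comp (d1 a)), fderiv_fun_add ((d3 a b).fun_sub (d3 b a)) ((d1 a).clm_comp (d1 b)),
    fderiv_fun_sub (d3 a b) (d3 b a)]
  simp only [add_apply, sub_apply]
  rw [fderiv_clm_comp_apply (d1 a) (d1 b), fderiv_clm_comp_apply (d1 b) (d1 a),
    fderiv_clm_apply_const dA, fderiv_clm_apply_const dA, fderiv_clm_apply_const (d2 a),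
    fderiv_clm_apply_const (d2 b), fderiv_clm_apply_const dA', fderiv_clm_apply_const dA']

lemma covDerivCurv_apply (hU : IsOpen U) (hA : ContDiffOn ℝ ∞ A U) {y : E} (hy : y ∈ U)
    (c a b : E) : covDerivCurv A y c a b =
      covDerivEnd A (fun z => curv A z a b) y c - curv A y (A y c a) b - curv A y a (A y c b) := by
  simp only [covDerivCurv, add_apply, derivAct_apply, covDerivEnd, fderiv_curv_apply hU hA hy]
  abel

lemma covDerivCurv_antisymm (hU : IsOpen U) (hA : ContDiffOn ℝ ∞ A U) {y : E} (hy : y ∈ U)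
    (c a b : E) : covDerivCurv A y c a b = - covDerivCurv A y c b a := by
  simp only [covDerivCurv, add_apply, derivAct_apply, fderiv_curv hU hA hy, curv_apply]
  ext w
  simp only [ContinuousLinearMap.comp_apply, add_apply, sub_apply, neg_apply, map_add, map_sub]
  abel

/-- The differential Bianchi identity of a torsion-free connection. -/
lemma covDerivCurv_bianchi (hU : IsOpen U) (hA : ContDiffOn ℝ ∞ A U) {y : E} (hy : y ∈ U)
    (hsymm : ∀ a b, A y a b = A y b a) (a b c : E) :
    covDerivCurv A y a b c + covDerivCurv A y b c a + covDerivCurv A y c a b = 0 := by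
  simp only [covDerivCurv, add_apply, derivAct_apply]
  rw [hsymm c a, hsymm b a, hsymm c b, curv_antisymm A y c (A y a b),
    curv_antisymm A y b (A y a c), curv_antisymm A y a (A y b c)]
  simp only [fderiv_curv hU hA hy, curv_apply A y b c, curv_apply A y c a, curv_apply A y a b]
  rw [snd_fderiv_symm hU hA hy b a, snd_fderiv_symm hU hA hy c a, snd_fderiv_symm hU hA hy c b]
  ext w
  simp only [ContinuousLinearMap.comp_apply, add_apply, sub_apply, neg_apply, map_add, map_sub,
    zero_apply]
  abel

end Connection

/-! ### The Levi-Civita connection of a metric in a coordinate domain -/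

/-- `h` is a smooth field of nondegenerate symmetric bilinear forms on the open set `U`. -/
structure IsMetricOn (h : E → E →L[ℝ] E →L[ℝ] ℝ) (U : Set E) : Prop where
  isOpen : IsOpen U
  smooth : ContDiffOn ℝ ∞ h U
  symm : ∀ y ∈ U, ∀ u v, h y u v = h y v u
  invertible : ∀ y ∈ U, (h y).IsInvertible

namespace IsMetricOn

variable {h : E → E →L[ℝ] E →L[ℝ] ℝ} {U : Set E} (H : IsMetricOn h U)
include H

lemma ext_inner {y : E} (hy : y ∈ U) {u v : E} (huv : ∀ w, h y u w = h y v w) : u = v :=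
  (H.invertible y hy).injective (ContinuousLinearMap.ext huv)

lemma inner_inverse {y : E} (hy : y ∈ U) (φ : E →L[ℝ] ℝ) (w : E) :
    h y ((h y).inverse φ) w = φ w := by
  rw [(H.invertible y hy).self_apply_inverse]

lemma differentiableAt {y : E} (hy : y ∈ U) : DifferentiableAt ℝ h y :=
  differentiableAt_of_contDiffOn H.isOpen H.smooth hy

lemma fderiv_symm {y : E} (hy : y ∈ U) (a u v : E) : fderiv ℝ h y a u v = fderiv ℝ h y a v u := by
  have h1 : ∀ u v, fderiv ℝ (fun z => h z u v) y a = fderiv ℝ h y a u v := fun u v => by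
    rw [fderiv_clm_apply_const ((H.differentiableAt hy).clm_apply (differentiableAt_const u)),
      fderiv_clm_apply_const (H.differentiableAt hy)]
  rw [← h1, ← h1, fderiv_eq_of_eqOn H.isOpen (fun z hz => H.symm z hz u v) hy]

lemma inner_christoffel {y : E} (hy : y ∈ U) (u v w : E) :
    h y (christoffel h y u v) w =
      (1 / 2) * (fderiv ℝ h y u v w + fderiv ℝ h y v u w - fderiv ℝ h y w u v) := by
  simp only [christoffel, ContinuousLinearMap.comp_apply, smul_apply, map_smul, smul_eq_mul,
    ContinuousLinearMap.compL_apply, H.inner_inverse hy]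
  simp

lemma christoffel_symm {y : E} (hy : y ∈ U) (u v : E) :
    christoffel h y u v = christoffel h y v u := by
  refine H.ext_inner hy fun w => ?_
  rw [H.inner_christoffel hy, H.inner_christoffel hy, H.fderiv_symm hy w u v]
  ring

/-- The Levi-Civita connection is metric. -/
lemma fderiv_eq {y : E} (hy : y ∈ U) (a u v : E) :
    fderiv ℝ h y a u v = h y (christoffel h y a u) v + h y u (christoffel h y a v) := by
  rw [H.symm y hy u, H.inner_christoffel hy, H.inner_christoffel hy, H.fderiv_symm hy a v u]
  ring

lemma contDiffOn_inverse [CompleteSpace E] : ContDiffOn ℝ ∞ (fun y => (h y).inverse) U := fun y hy =>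
  ContDiffAt.comp_contDiffWithinAt y (H.invertible y hy).contDiffAt_map_inverse (H.smooth y hy)

lemma contDiffOn_christoffel [FiniteDimensional ℝ E] : ContDiffOn ℝ ∞ (christoffel h) U := by
  have : CompleteSpace E := FiniteDimensional.complete ℝ E
  refine contDiffOn_clm_apply.2 fun u => contDiffOn_clm_apply.2 fun v => ?_
  have h1 : ∀ u v, ContDiffOn ℝ ∞ (fun y => fderiv ℝ h y u v) U := fun u v =>
    ((contDiffOn_fderiv H.isOpen H.smooth).clm_apply contDiffOn_const).clm_apply contDiffOn_const
  have h2 : ContDiffOn ℝ ∞ (fun y => (fderiv ℝ h y).flip u |>.flip v) U := by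
    refine contDiffOn_clm_apply.2 fun w => ?_
    simpa using (h1 w u).clm_apply contDiffOn_const
  have h3 := (H.contDiffOn_inverse.clm_apply (((h1 u v).add (h1 v u)).sub h2)).const_smul (1 / 2 : ℝ)
  refine h3.congr fun y hy => ?_
  refine H.ext_inner hy fun w => ?_
  rw [H.inner_christoffel hy]
  simp [H.inner_inverse hy]

/-- The derivative of an inner product, by the compatibility of the connection with the metric. -/
lemma fderiv_inner {V W : E → E} {y : E} (hy : y ∈ U) (hV : DifferentiableAt ℝ V y)
    (hW : DifferentiableAt ℝ W y) (a : E) :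
    fderiv ℝ (fun z => h z (V z) (W z)) y a =
      h y (covDeriv h V y a) (W y) + h y (V y) (covDeriv h W y a) := by
  rw [fderiv_form_apply (H.differentiableAt hy) hV hW, H.fderiv_eq hy]
  simp only [covDeriv, add_apply, ContinuousLinearMap.flip_apply, map_add]
  ring

/-- If a field of endomorphisms is skew, so are its covariant derivatives. -/
lemma skew_covDerivEnd {T : E → E →L[ℝ] E} (hT : ∀ y ∈ U, ∀ u v, h y (T y u) v + h y u (T y v) = 0)
    {y : E} (hy : y ∈ U) (dT : DifferentiableAt ℝ T y) (a u v : E) :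
    h y (covDerivEnd (christoffel h) T y a u) v + h y u (covDerivEnd (christoffel h) T y a v)
      = 0 := by
  have hc : ∀ u, DifferentiableAt ℝ (fun z => T z u) y := fun u =>
    dT.clm_apply (differentiableAt_const u)
  have h1 : fderiv ℝ (fun z => h z (T z u) v + h z u (T z v)) y a = 0 := by
    rw [fderiv_eq_of_eqOn H.isOpen (fun z hz => hT z hz u v) hy]; simp
  have dh := H.differentiableAt hy
  rw [fderiv_fun_add ((dh.clm_apply (hc u)).clm_apply (differentiableAt_const v))
    ((dh.clm_apply (differentiableAt_const u)).clm_apply (hc v)), add_apply,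
    fderiv_form_apply dh (hc u) (differentiableAt_const v),
    fderiv_form_apply dh (differentiableAt_const u) (hc v), fderiv_clm_apply_const dT,
    fderiv_clm_apply_const dT, H.fderiv_eq hy, H.fderiv_eq hy] at h1
  simp only [fderiv_fun_const, Pi.zero_apply, zero_apply, map_zero] at h1
  have h2 := hT y hy u (christoffel h y a v)
  have h3 := hT y hy (christoffel h y a u) v
  simp only [covDerivEnd, add_apply, sub_apply, ContinuousLinearMap.comp_apply, map_add, map_sub]
  linarith

/-- The exterior derivative of the 1-form dual to a Killing field `Y` is `2 h(∇Y, ·)`. -/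
lemma extDeriv_killing {Y : E → E} (hY : ContDiffOn ℝ ∞ Y U)
    (hK : ∀ y ∈ U, ∀ u v, h y (covDeriv h Y y u) v + h y u (covDeriv h Y y v) = 0)
    {y : E} (hy : y ∈ U) (u v : E) :
    fderiv ℝ (fun z => h z (Y z)) y u v - fderiv ℝ (fun z => h z (Y z)) y v u =
      2 * h y (covDeriv h Y y u) v := by
  have dh := H.differentiableAt hy
  have dY := differentiableAt_of_contDiffOn H.isOpen hY hy
  rw [fderiv_clm_apply_apply dh dY, fderiv_clm_apply_apply dh dY, add_apply, add_apply,
    H.fderiv_eq hy, H.fderiv_eq hy]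
  have := hK y hy u v
  rw [H.symm y hy u] at this
  simp only [covDeriv, add_apply, ContinuousLinearMap.flip_apply, map_add] at this ⊢
  rw [H.christoffel_symm hy v u]
  linarith

/-- The covariant derivative of the endomorphism field of `f V ⊗ V + g W ⊗ W`. -/
lemma covDerivEnd_smulRight {f : E → ℝ} {V : E → E} {y : E} (hy : y ∈ U)
    (df : DifferentiableAt ℝ f y) (dV : DifferentiableAt ℝ V y) {T : E → E →L[ℝ] E} (dT : DifferentiableAt ℝ T y) {W : E → E}
    (dW : DifferentiableAt ℝ W y) {g : E → ℝ} (dg : DifferentiableAt ℝ g y)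
    (hT : ∀ z ∈ U, ∀ b, T z b = (f z * h z (V z) b) • V z + (g z * h z (W z) b) • W z) (a b : E) :
    covDerivEnd (christoffel h) T y a b =
      (fderiv ℝ f y a * h y (V y) b + f y * h y (covDeriv h V y a) b) • V y
      + (f y * h y (V y) b) • covDeriv h V y a
      + (fderiv ℝ g y a * h y (W y) b + g y * h y (covDeriv h W y a) b) • W y
      + (g y * h y (W y) b) • covDeriv h W y a := by
  have dh := H.differentiableAt hy
  have dVb := (dh.clm_apply dV).clm_apply (differentiableAt_const b)
  have dWb := (dh.clm_apply dW).clm_apply (differentiableAt_const b)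
  have e : ∀ {V : E → E}, DifferentiableAt ℝ V y → fderiv ℝ (fun z => h z (V z) b) y a =
      h y (covDeriv h V y a) b + h y (V y) (christoffel h y a b) := fun dV => by
    rw [H.fderiv_inner hy dV (differentiableAt_const b)]
    simp [covDeriv]
  have h1 : fderiv ℝ T y a b =
      (f y * (h y (covDeriv h V y a) b + h y (V y) (christoffel h y a b))
        + fderiv ℝ f y a * h y (V y) b) • V y + (f y * h y (V y) b) • fderiv ℝ V y a
      + ((g y * (h y (covDeriv h W y a) b + h y (W y) (christoffel h y a b))
        + fderiv ℝ g y a * h y (W y) b) • W y + (g y * h y (W y) b) • fderiv ℝ W y a) := by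
    rw [← fderiv_clm_apply_const dT, fderiv_eq_of_eqOn H.isOpen (fun z hz => hT z hz b) hy,
      fderiv_fun_add ((df.fun_mul dVb).fun_smul dV) ((dg.fun_mul dWb).fun_smul dW), add_apply,
      fderiv_fun_smul (df.fun_mul dVb) dV, fderiv_fun_smul (dg.fun_mul dWb) dW,
      fderiv_fun_mul df dVb, fderiv_fun_mul dg dWb]
    simp only [add_apply, smul_apply, ContinuousLinearMap.smulRight_apply, e dV, e dW, smul_eq_mul]
    module
  simp only [covDerivEnd, add_apply, sub_apply, ContinuousLinearMap.comp_apply, h1, hT y hy,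
    covDeriv, ContinuousLinearMap.flip_apply, map_add, map_smul]
  module

variable [FiniteDimensional ℝ E]

/-- The curvature endomorphisms are skew. -/
lemma skew_curv {y : E} (hy : y ∈ U) (a b u v : E) :
    h y (curv (christoffel h) y a b u) v + h y u (curv (christoffel h) y a b v) = 0 := by
  set A := christoffel h with hA
  have sA : ContDiffOn ℝ ∞ A U := H.contDiffOn_christoffel
  have dA := differentiableAt_of_contDiffOn H.isOpen sA hy
  have dh := H.differentiableAt hy
  have dh' := differentiableAt_of_contDiffOn H.isOpen (contDiffOn_fderiv H.isOpen H.smooth) hy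
  -- the second derivative of the metric, from its first derivative in terms of the connection
  have key : ∀ a b, fderiv ℝ (fderiv ℝ h) y b a u v =
      h y (A y b (A y a u)) v + h y (A y a u) (A y b v) + h y (fderiv ℝ A y b a u) v
      + h y (A y b u) (A y a v) + h y u (A y b (A y a v)) + h y u (fderiv ℝ A y b a v) := by
    intro a b
    have hc : ∀ u, DifferentiableAt ℝ (fun z => A z a u) y := fun u =>
      (dA.clm_apply (differentiableAt_const a)).clm_apply (differentiableAt_const u)
    have dAa := dA.clm_apply (differentiableAt_const a)
    have e1 : ∀ u, fderiv ℝ (fun z => A z a u) y b = fderiv ℝ A y b a u := fun u => by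
      rw [fderiv_clm_apply_const dAa, fderiv_clm_apply_const dA]
    have e2 : fderiv ℝ (fun z => fderiv ℝ h z a u v) y b = fderiv ℝ (fderiv ℝ h) y b a u v := by
      have d1 := dh'.clm_apply (differentiableAt_const a)
      rw [fderiv_clm_apply_const (d1.clm_apply (differentiableAt_const u)),
        fderiv_clm_apply_const d1, fderiv_clm_apply_const dh']
    rw [← e2, fderiv_eq_of_eqOn H.isOpen (fun z hz => H.fderiv_eq hz a u v) hy,
      fderiv_fun_add ((dh.clm_apply (hc u)).clm_apply (differentiableAt_const v))
        ((dh.clm_apply (differentiableAt_const u)).clm_apply (hc v)), add_apply,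
      fderiv_form_apply dh (hc u) (differentiableAt_const v),
      fderiv_form_apply dh (differentiableAt_const u) (hc v), e1, e1, H.fderiv_eq hy,
      H.fderiv_eq hy]
    simp only [fderiv_fun_const, Pi.zero_apply, zero_apply, map_zero, ← hA]
    ring
  have h1 := key a b
  rw [snd_fderiv_symm H.isOpen H.smooth hy b a, key b a] at h1
  simp only [curv_apply, add_apply, sub_apply, ContinuousLinearMap.comp_apply, map_add, map_sub]
  linarith

lemma curv_cyclic {y : E} (hy : y ∈ U) (a b c : E) :
    curv (christoffel h) y a b c + curv (christoffel h) y b c a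
      + curv (christoffel h) y c a b = 0 :=
  curv_bianchi H.isOpen H.contDiffOn_christoffel (fun _ hz => H.christoffel_symm hz) hy a b c

/-- The pair symmetry of the curvature. -/
lemma curv_pair {y : E} (hy : y ∈ U) (a b c d : E) :
    h y (curv (christoffel h) y a b c) d = h y (curv (christoffel h) y c d a) b := by
  have s := fun a b u v => by
    have := H.skew_curv hy a b u v
    rwa [H.symm y hy u] at this
  have t := fun a b c d => congrArg (fun x => h y x d) (curv_antisymm (christoffel h) y a b ▸ rfl :
    curv (christoffel h) y a b c = (- curv (christoffel h) y b a) c)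
  -- the sum of the four cyclic identities in `a, b, c, d` reduces by the two antisymmetries
  have B := fun a b c d => congrArg (fun x => h y x d) (H.curv_cyclic hy a b c)
  simp only [map_add, add_apply, map_zero, zero_apply, neg_apply, map_neg] at B t
  have := B a b c d
  have := B b c d a
  have := B c d a b
  have := B d a b c
  have := t a b c d
  have := t c d a b
  have := s a b c d
  have := s b c a d
  have := s c a b d
  have := s c d b a
  have := s d b c a
  have := s b c d a
  have := s d a c b
  have := s a c d b
  have := s c d a b
  have := s a b d c
  have := s b d a c
  have := s d a b c
  have := t d b a c
  have := t d b c a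
  have := t c a d b
  have := t c a b d
  linarith

lemma skew_covDerivCurv {y : E} (hy : y ∈ U) (c a b u v : E) :
    h y (covDerivCurv (christoffel h) y c a b u) v
      + h y u (covDerivCurv (christoffel h) y c a b v) = 0 := by
  have sA := H.contDiffOn_christoffel
  have d := ((differentiableAt_of_contDiffOn H.isOpen (contDiffOn_curv H.isOpen sA) hy).clm_apply
    (differentiableAt_const a)).clm_apply (differentiableAt_const b)
  have h1 := H.skew_covDerivEnd (T := fun z => curv (christoffel h) z a b)
    (fun z hz => H.skew_curv hz a b) hy d c u v
  have h2 := H.skew_curv hy (christoffel h y c a) b u v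
  have h3 := H.skew_curv hy a (christoffel h y c b) u v
  rw [covDerivCurv_apply H.isOpen sA hy]
  simp only [sub_apply, map_sub]
  linarith

end IsMetricOn

/-! ### Ricci curvature and the contracted Bianchi identity -/

variable [FiniteDimensional ℝ E]

variable (E) in
/-- The trace of a continuous endomorphism, as a continuous linear form. -/
def traceL : (E →L[ℝ] E) →L[ℝ] ℝ :=
  LinearMap.toContinuousLinearMap (LinearMap.trace ℝ E ∘ₗ ContinuousLinearMap.coeLM ℝ)

lemma traceL_apply (L : E →L[ℝ] E) : traceL E L = LinearMap.trace ℝ E L := rfl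

lemma traceL_comp_comm (L L' : E →L[ℝ] E) : traceL E (L ∘L L') = traceL E (L' ∘L L) :=
  LinearMap.trace_mul_comm ℝ (L : E →ₗ[ℝ] E) (L' : E →ₗ[ℝ] E)

lemma traceL_smulRight (φ : E →L[ℝ] ℝ) (x : E) : traceL E (φ.smulRight x) = φ x :=
  LinearMap.trace_smulRight (φ : E →ₗ[ℝ] ℝ) x

lemma traceL_eq_sum {ι : Type*} [Fintype ι] (b : Module.Basis ι ℝ E) (L : E →L[ℝ] E) :
    traceL E L = ∑ i, b.coord i (L (b i)) := by
  classical
  rw [traceL_apply, LinearMap.trace_eq_matrix_trace ℝ b]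
  simp [Matrix.trace, LinearMap.toMatrix_apply]

/-- The Ricci contraction `R ↦ tr (u ↦ R(u, b) w)`. -/
def ricContr (b w : E) : (E →L[ℝ] E →L[ℝ] E →L[ℝ] E) →L[ℝ] ℝ :=
  LinearMap.toContinuousLinearMap
    { toFun := fun R => traceL E ((R.flip b).flip w)
      map_add' := fun R R' => by rw [← map_add]; rfl
      map_smul' := fun c R => by rw [RingHom.id_apply, ← map_smul]; rfl }

lemma ricContr_apply (b w : E) (R : E →L[ℝ] E →L[ℝ] E →L[ℝ] E) :
    ricContr b w R = traceL E ((R.flip b).flip w) := rfl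

lemma ricContr_derivAct (Q : E →L[ℝ] E) (R : E →L[ℝ] E →L[ℝ] E →L[ℝ] E) (b w : E) :
    ricContr b w (derivAct Q R) = - ricContr (Q b) w R - ricContr b (Q w) R := by
  have h : ((derivAct Q R).flip b).flip w =
      Q ∘L ((R.flip b).flip w) - ((R.flip b).flip w) ∘L Q
        - ((R.flip b).flip (Q w)) - ((R.flip (Q b)).flip w) := by
    ext u
    simp only [ContinuousLinearMap.flip_apply, derivAct_apply, sub_apply,
      ContinuousLinearMap.comp_apply]
    abel
  rw [ricContr_apply, h, map_sub, map_sub, map_sub, traceL_comp_comm, ricContr_apply,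
    ricContr_apply]
  ring

lemma ricci_eq_ricContr (h : E → E →L[ℝ] E →L[ℝ] ℝ) (y b w : E) :
    ricci h y b w = ricContr b w (curv (christoffel h) y) := by
  have : riemannEnd h y b w = (((curv (christoffel h) y).flip b).flip w : E →L[ℝ] E) := by
    ext u; exact riemann_eq_curv h y u b w
  rw [ricContr_apply, traceL_apply, ← this]
  rfl

/-- The Ricci endomorphism. -/
def ricciEnd (h : E → E →L[ℝ] E →L[ℝ] ℝ) (y : E) : E →L[ℝ] E := (h y).inverse ∘L ricci h y

lemma scalar_eq (h : E → E →L[ℝ] E →L[ℝ] ℝ) (y : E) : scalar h y = traceL E (ricciEnd h y) := rfl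

namespace IsMetricOn

variable {h : E → E →L[ℝ] E →L[ℝ] ℝ} {U : Set E} (H : IsMetricOn h U)
include H

lemma contDiffOn_ricci : ContDiffOn ℝ ∞ (ricci h) U := by
  refine contDiffOn_clm_apply.2 fun b => contDiffOn_clm_apply.2 fun w => ?_
  simp only [ricci_eq_ricContr]
  exact (ricContr b w).contDiff.comp_contDiffOn (contDiffOn_curv H.isOpen H.contDiffOn_christoffel)

lemma contDiffOn_ricciEnd : ContDiffOn ℝ ∞ (ricciEnd h) U := by
  have : CompleteSpace E := FiniteDimensional.complete ℝ E
  exact H.contDiffOn_inverse.clm_comp H.contDiffOn_ricci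

lemma contDiffOn_scalar : ContDiffOn ℝ ∞ (scalar h) U :=
  (traceL E).contDiff.comp_contDiffOn H.contDiffOn_ricciEnd

lemma inner_ricciEnd {y : E} (hy : y ∈ U) (v w : E) :
    h y (ricciEnd h y v) w = ricContr v w (curv (christoffel h) y) := by
  rw [← ricci_eq_ricContr]
  exact H.inner_inverse hy _ w

/-- The covariant derivative of the Ricci endomorphism contracts that of the curvature. -/
lemma inner_covDerivEnd_ricciEnd {y : E} (hy : y ∈ U) (c b w : E) :
    h y (covDerivEnd (christoffel h) (ricciEnd h) y c b) w =
      ricContr b w (covDerivCurv (christoffel h) y c) := by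
  have sA := H.contDiffOn_christoffel
  have dR := differentiableAt_of_contDiffOn H.isOpen (contDiffOn_curv H.isOpen sA) hy
  have dρ := differentiableAt_of_contDiffOn H.isOpen H.contDiffOn_ricciEnd hy
  have h1 : fderiv ℝ (fun z => h z (ricciEnd h z b) w) y c =
      ricContr b w (fderiv ℝ (curv (christoffel h)) y c) := by
    rw [fderiv_eq_of_eqOn H.isOpen (fun z hz => H.inner_ricciEnd hz b w) hy]
    exact congrArg (fun L => L c) ((ricContr b w).hasFDerivAt.comp y dR.hasFDerivAt).fderiv
  rw [fderiv_form_apply (H.differentiableAt hy) (dρ.clm_apply (differentiableAt_const b))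
    (differentiableAt_const w), fderiv_clm_apply_const dρ, H.fderiv_eq hy] at h1
  simp only [fderiv_fun_const, Pi.zero_apply, zero_apply, map_zero] at h1
  have h2 := H.inner_ricciEnd hy b (christoffel h y c w)
  have h3 := H.inner_ricciEnd hy (christoffel h y c b) w
  rw [covDerivCurv, map_add, ricContr_derivAct]
  simp only [covDerivEnd, add_apply, sub_apply, ContinuousLinearMap.comp_apply, map_add, map_sub]
  linarith

/-- The trace commutes with covariant derivatives. -/
lemma traceL_covDerivEnd_ricciEnd {y : E} (hy : y ∈ U) (c : E) :
    traceL E (covDerivEnd (christoffel h) (ricciEnd h) y c) = fderiv ℝ (scalar h) y c := by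
  have dρ := differentiableAt_of_contDiffOn H.isOpen H.contDiffOn_ricciEnd hy
  have h1 : fderiv ℝ (scalar h) y c = traceL E (fderiv ℝ (ricciEnd h) y c) :=
    congrArg (fun L => L c) ((traceL E).hasFDerivAt.comp y dρ.hasFDerivAt).fderiv
  rw [h1, covDerivEnd, map_sub, map_add, traceL_comp_comm]
  ring

/-- The contracted Bianchi identity `div Ric = dS / 2`. -/
theorem div_ricciEnd {y : E} (hy : y ∈ U) (c : E) (L : E →L[ℝ] E)
    (hL : ∀ a, L a = covDerivEnd (christoffel h) (ricciEnd h) y a c) :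
    2 * traceL E L = fderiv ℝ (scalar h) y c := by
  have sA := H.contDiffOn_christoffel
  let e := Module.finBasis ℝ E
  -- the basis dual to `e` with respect to the metric, so that traces are `∑ i, h (T (e i)) (f i)`
  let f : Fin (Module.finrank ℝ E) → E := fun i =>
    (h y).inverse (LinearMap.toContinuousLinearMap (e.coord i))
  have hf : ∀ i v, e.coord i v = h y v (f i) := fun i v => by
    rw [H.symm y hy, H.inner_inverse hy]; rfl
  have htr : ∀ T : E →L[ℝ] E, traceL E T = ∑ i, h y (T (e i)) (f i) := fun T => by
    rw [traceL_eq_sum e]; simp only [hf]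
  have hric : ∀ b w R, ricContr b w R = ∑ i, h y (R (e i) b w) (f i) := fun b w R => htr _
  -- the double trace of the differential Bianchi identity
  let N := covDerivCurv (christoffel h) y
  have h1 : ∑ i, ∑ j, (h y (N (e i) (e j) c (f j)) (f i) + h y (N (e j) c (e i) (f j)) (f i)
      + h y (N c (e i) (e j) (f j)) (f i)) = 0 := by
    refine Finset.sum_eq_zero fun i _ => Finset.sum_eq_zero fun j _ => ?_
    have := congrArg (fun T => h y (T (f j)) (f i)) (covDerivCurv_bianchi H.isOpen sA hy
      (H.christoffel_symm hy) (e i) (e j) c)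
    simp only [add_apply, map_add, zero_apply, map_zero] at this
    exact this
  have h2 : ∀ i j, h y (N (e i) (e j) c (f j)) (f i) = - h y (N (e i) (e j) c (f i)) (f j) :=
    fun i j => by
      have := H.skew_covDerivCurv hy (e i) (e j) c (f j) (f i)
      rw [H.symm y hy (f j)] at this
      linarith
  have h3 : ∀ i j, h y (N (e j) c (e i) (f j)) (f i) = - h y (N (e j) (e i) c (f j)) (f i) :=
    fun i j => by
      simp only [N]
      rw [covDerivCurv_antisymm H.isOpen sA hy, neg_apply, map_neg, neg_apply]
  have h4 : ∑ i, ∑ j, h y (N (e i) (e j) c (f i)) (f j) = traceL E L := by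
    rw [htr]
    refine Finset.sum_congr rfl fun i _ => ?_
    rw [hL, H.inner_covDerivEnd_ricciEnd hy, hric]
  have h5 : ∑ i, ∑ j, h y (N (e j) (e i) c (f j)) (f i) = traceL E L := by
    rw [Finset.sum_comm]; exact h4
  have h6 : ∑ i, ∑ j, h y (N c (e i) (e j) (f j)) (f i) = fderiv ℝ (scalar h) y c := by
    rw [← H.traceL_covDerivEnd_ricciEnd hy, htr, Finset.sum_comm]
    refine Finset.sum_congr rfl fun i _ => ?_
    rw [H.inner_covDerivEnd_ricciEnd hy, hric]
  simp only [h2, h3, Finset.sum_add_distrib, Finset.sum_neg_distrib] at h1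
  rw [h4, h5, h6] at h1
  linarith

/-- The trace of a skew endomorphism vanishes. -/
lemma traceL_eq_zero_of_skew {y : E} (hy : y ∈ U) {P : E →L[ℝ] E}
    (hP : ∀ u v, h y (P u) v + h y u (P v) = 0) : traceL E P = 0 := by
  obtain ⟨e, he⟩ := H.invertible y hy
  let e' : E ≃ₗ[ℝ] Module.Dual ℝ E :=
    e.toLinearEquiv.trans (LinearMap.toContinuousLinearMap (𝕜 := ℝ) (E := E) (F' := ℝ)).symm
  have he' : ∀ u v, e' u v = h y u v := fun u v => by rw [← he]; rfl
  have h1 : Module.Dual.transpose (R := ℝ) (P : E →ₗ[ℝ] E) = - e'.conj (P : E →ₗ[ℝ] E) := by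
    refine LinearMap.ext fun φ => LinearMap.ext fun v => ?_
    obtain ⟨u, rfl⟩ := e'.surjective φ
    rw [Module.Dual.transpose_apply, LinearMap.neg_apply, LinearMap.neg_apply,
      LinearEquiv.conj_apply_apply, e'.symm_apply_apply, LinearMap.comp_apply, he', he']
    have h0 := hP u v
    change h y u (P v) = -(h y (P u) v)
    linarith
  -- `P` is conjugate to minus its transpose
  have h2 := LinearMap.trace_transpose' (R := ℝ) (P : E →ₗ[ℝ] E)
  rw [h1, map_neg, LinearMap.trace_conj'] at h2
  rw [traceL_apply]
  linarith

end IsMetricOn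

/-! ### Killing fields -/

namespace IsMetricOn

variable {h : E → E →L[ℝ] E →L[ℝ] ℝ} {U : Set E} (H : IsMetricOn h U)
include H

lemma contDiffOn_covDeriv {V : E → E} (hV : ContDiffOn ℝ ∞ V U) :
    ContDiffOn ℝ ∞ (covDeriv h V) U := by
  refine contDiffOn_clm_apply.2 fun v => ?_
  have h1 := (contDiffOn_fderiv H.isOpen hV).clm_apply (contDiffOn_const (c := v))
  have h2 := (H.contDiffOn_christoffel.clm_apply (contDiffOn_const (c := v))).clm_apply hV
  exact (h1.add h2).congr fun y _ => by simp [covDeriv]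

/-- The Ricci identity for second covariant derivatives of a vector field. -/
lemma covDerivEnd_covDeriv_comm {V : E → E} (hV : ContDiffOn ℝ ∞ V U) {y : E} (hy : y ∈ U)
    (a b : E) :
    covDerivEnd (christoffel h) (covDeriv h V) y a b
      - covDerivEnd (christoffel h) (covDeriv h V) y b a =
      curv (christoffel h) y a b (V y) := by
  have sA := H.contDiffOn_christoffel
  have dA := differentiableAt_of_contDiffOn H.isOpen sA hy
  have dV := differentiableAt_of_contDiffOn H.isOpen hV hy
  have dV' := differentiableAt_of_contDiffOn H.isOpen (contDiffOn_fderiv H.isOpen hV) hy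
  have dP := differentiableAt_of_contDiffOn H.isOpen (H.contDiffOn_covDeriv hV) hy
  have key : ∀ a b, fderiv ℝ (covDeriv h V) y a b = fderiv ℝ (fderiv ℝ V) y a b
      + fderiv ℝ (christoffel h) y a b (V y) + christoffel h y b (fderiv ℝ V y a) := by
    intro a b
    have dAb := dA.clm_apply (differentiableAt_const b)
    have dVb := dV'.clm_apply (differentiableAt_const b)
    rw [← fderiv_clm_apply_const dP]
    simp only [covDeriv, add_apply, ContinuousLinearMap.flip_apply]
    rw [fderiv_fun_add dVb (dAb.clm_apply dV), add_apply, fderiv_clm_apply_const dV',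
      fderiv_clm_apply_apply dAb dV, fderiv_clm_apply_const dA]
    abel
  simp only [covDerivEnd, add_apply, sub_apply, key, ContinuousLinearMap.comp_apply, curv_apply]
  rw [snd_fderiv_symm H.isOpen hV hy a b, H.christoffel_symm hy a b]
  simp only [covDeriv, add_apply, ContinuousLinearMap.flip_apply, map_add]
  abel

/-- The second covariant derivative of a Killing field is `∇_a ∇Y = R(a, Y)`. -/
theorem covDerivEnd_killing {Y : E → E} (hY : ContDiffOn ℝ ∞ Y U)
    (hK : ∀ y ∈ U, ∀ u v, h y (covDeriv h Y y u) v + h y u (covDeriv h Y y v) = 0)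
    {y : E} (hy : y ∈ U) (a : E) :
    covDerivEnd (christoffel h) (covDeriv h Y) y a = curv (christoffel h) y a (Y y) := by
  have dP := differentiableAt_of_contDiffOn H.isOpen (H.contDiffOn_covDeriv hY) hy
  ext b
  refine H.ext_inner hy fun c => ?_
  rw [H.curv_pair hy]
  have s : ∀ a b c, h y (covDerivEnd (christoffel h) (covDeriv h Y) y a b) c
      + h y (covDerivEnd (christoffel h) (covDeriv h Y) y a c) b = 0 := fun a b c => by
    rw [H.symm y hy _ b]; exact H.skew_covDerivEnd hK hy dP a b c
  have r : ∀ a b c, h y (covDerivEnd (christoffel h) (covDeriv h Y) y a b) c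
      - h y (covDerivEnd (christoffel h) (covDeriv h Y) y b a) c
      = - h y (curv (christoffel h) y a b c) (Y y) := fun a b c => by
    rw [← sub_apply, ← map_sub, H.covDerivEnd_covDeriv_comm hY hy]
    have := H.skew_curv hy a b (Y y) c
    rw [H.symm y hy (Y y)] at this
    linarith
  have B := congrArg (fun x => h y x (Y y)) (H.curv_cyclic hy a b c)
  simp only [map_add, add_apply, map_zero, zero_apply] at B
  linarith [r a b c, r b c a, r c a b, s a b c, s b a c, s b c a, s c a b]

/-- The Lie derivative of the curvature along a Killing field vanishes. -/
theorem covDerivCurv_killing {Y : E → E} (hY : ContDiffOn ℝ ∞ Y U)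
    (hK : ∀ y ∈ U, ∀ u v, h y (covDeriv h Y y u) v + h y u (covDeriv h Y y v) = 0)
    {y : E} (hy : y ∈ U) :
    covDerivCurv (christoffel h) y (Y y) = derivAct (covDeriv h Y y) (curv (christoffel h) y) := by
  have sA := H.contDiffOn_christoffel
  have sR := contDiffOn_curv H.isOpen sA
  have dR := differentiableAt_of_contDiffOn H.isOpen sR hy
  have dY := differentiableAt_of_contDiffOn H.isOpen hY hy
  have key : ∀ a b, covDerivEnd (christoffel h)
      (fun z => covDerivEnd (christoffel h) (covDeriv h Y) z b) y a =
      covDerivCurv (christoffel h) y a b (Y y)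
        + curv (christoffel h) y (christoffel h y a b) (Y y)
        + curv (christoffel h) y b (covDeriv h Y y a) := by
    intro a b
    have dRb := dR.clm_apply (differentiableAt_const b)
    have e : ∀ S, covDerivEnd (christoffel h) S y a = fderiv ℝ S y a + christoffel h y a ∘L S y
      - S y ∘L christoffel h y a := fun _ => rfl
    rw [covDerivCurv_apply H.isOpen sA hy, e, e (fun z => curv (christoffel h) z b (Y y)),
      fderiv_eq_of_eqOn H.isOpen (fun z hz => H.covDerivEnd_killing hY hK hz b) hy,
      H.covDerivEnd_killing hY hK hy b, fderiv_clm_apply_apply dRb dY, fderiv_clm_apply_const dRb]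
    simp only [covDeriv, add_apply, ContinuousLinearMap.flip_apply, map_add]
    abel
  ext a b : 2
  have h1 := covDerivEnd_comm H.isOpen sA (H.contDiffOn_covDeriv hY) hy a b
  rw [key, key, H.christoffel_symm hy b a] at h1
  have h2 := covDerivCurv_bianchi H.isOpen sA hy (H.christoffel_symm hy) a b (Y y)
  rw [covDerivCurv_antisymm H.isOpen sA hy b (Y y) a] at h2
  rw [derivAct_apply, curv_antisymm _ y (covDeriv h Y y a) b]
  have h3 : covDerivCurv (christoffel h) y (Y y) a b = covDerivCurv (christoffel h) y b a (Y y)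
      - covDerivCurv (christoffel h) y a b (Y y) := by
    rw [← sub_eq_zero, ← h2]; abel
  rw [h3]
  linear_combination (norm := module) (-1 : ℝ) • h1

/-- The Lie derivative of the Ricci endomorphism along a Killing field vanishes. -/
theorem covDerivEnd_ricciEnd_killing {Y : E → E} (hY : ContDiffOn ℝ ∞ Y U)
    (hK : ∀ y ∈ U, ∀ u v, h y (covDeriv h Y y u) v + h y u (covDeriv h Y y v) = 0)
    {y : E} (hy : y ∈ U) :
    covDerivEnd (christoffel h) (ricciEnd h) y (Y y) =
      covDeriv h Y y ∘L ricciEnd h y - ricciEnd h y ∘L covDeriv h Y y := by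
  ext b
  refine H.ext_inner hy fun w => ?_
  rw [H.inner_covDerivEnd_ricciEnd hy, H.covDerivCurv_killing hY hK hy, ricContr_derivAct,
    ← H.inner_ricciEnd hy, ← H.inner_ricciEnd hy]
  simp only [sub_apply, ContinuousLinearMap.comp_apply, map_sub]
  linarith [hK y hy (ricciEnd h y b) w]

theorem fderiv_scalar_killing {Y : E → E} (hY : ContDiffOn ℝ ∞ Y U)
    (hK : ∀ y ∈ U, ∀ u v, h y (covDeriv h Y y u) v + h y u (covDeriv h Y y v) = 0)
    {y : E} (hy : y ∈ U) : fderiv ℝ (scalar h) y (Y y) = 0 := by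
  rw [← H.traceL_covDerivEnd_ricciEnd hy, H.covDerivEnd_ricciEnd_killing hY hK hy, map_sub,
    traceL_comp_comm, sub_self]

/-- The divergence of the exterior derivative of a Killing field is `-2 Ric(Y, ·)`. -/
theorem divForm_killing {Y : E → E} (hY : ContDiffOn ℝ ∞ Y U)
    (hK : ∀ y ∈ U, ∀ u v, h y (covDeriv h Y y u) v + h y u (covDeriv h Y y v) = 0)
    {F : E → E →L[ℝ] E →L[ℝ] ℝ}
    (hF : ∀ y ∈ U, ∀ u v, F y u v = 2 * h y (covDeriv h Y y u) v)
    {y : E} (hy : y ∈ U) (w : E) :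
    divForm h F y w = - 2 * ricci h y (Y y) w := by
  have dh := H.differentiableAt hy
  have dP := differentiableAt_of_contDiffOn H.isOpen (H.contDiffOn_covDeriv hY) hy
  have sF : ContDiffOn ℝ ∞ F U := by
    refine contDiffOn_clm_apply.2 fun u => contDiffOn_clm_apply.2 fun v => ?_
    refine ContDiffOn.congr (f := fun y => 2 * h y (covDeriv h Y y u) v) ?_
      (fun y hy => hF y hy u v)
    exact contDiffOn_const.mul ((H.smooth.clm_apply ((H.contDiffOn_covDeriv hY).clm_apply
      contDiffOn_const)).clm_apply contDiffOn_const)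
  have dF := differentiableAt_of_contDiffOn H.isOpen sF hy
  have h1 : ∀ u v, fderiv ℝ F y u v w = 2 * (h y (covDerivEnd (christoffel h) (covDeriv h Y) y u v) w
      + h y (covDeriv h Y y (christoffel h y u v)) w
      + h y (covDeriv h Y y v) (christoffel h y u w)) := by
    intro u v
    have dPv := dP.clm_apply (differentiableAt_const v)
    have e : fderiv ℝ (fun z => F z v w) y u = fderiv ℝ F y u v w := by
      rw [fderiv_clm_apply_const (dF.clm_apply (differentiableAt_const v)),
        fderiv_clm_apply_const dF]
    rw [← e, fderiv_eq_of_eqOn H.isOpen (fun z hz => hF z hz v w) hy,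
      fderiv_const_mul ((dh.clm_apply dPv).clm_apply (differentiableAt_const w)), smul_apply,
      fderiv_form_apply dh dPv (differentiableAt_const w), fderiv_clm_apply_const dP,
      H.fderiv_eq hy]
    simp only [fderiv_fun_const, Pi.zero_apply, zero_apply, map_zero, covDerivEnd, add_apply,
      sub_apply, ContinuousLinearMap.comp_apply, map_add, map_sub, smul_eq_mul]
    ring
  have h2 : ∀ u v, h y (covDerivFormEnd h F y w u) v =
      2 * h y (curv (christoffel h) y u (Y y) v) w := by
    intro u v
    change h y ((h y).inverse _) v = _
    rw [H.inner_inverse hy]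
    simp only [sub_apply, ContinuousLinearMap.flip_apply, ContinuousLinearMap.comp_apply, h1,
      hF y hy, H.covDerivEnd_killing hY hK hy]
    ring
  have h3 : (covDerivFormEnd h F y w) =
      ((-2 : ℝ) • (((curv (christoffel h) y).flip (Y y)).flip w) : E →L[ℝ] E) := by
    ext u
    refine H.ext_inner hy fun v => ?_
    rw [h2]
    have := H.skew_curv hy u (Y y) v w
    rw [H.symm y hy v] at this
    change _ = h y ((-2 : ℝ) • (curv (christoffel h) y u (Y y) w)) v
    rw [map_smul, smul_apply, smul_eq_mul]
    linarith
  change LinearMap.trace ℝ E (covDerivFormEnd h F y w) = _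
  rw [h3, ← traceL_apply, map_smul, ricci_eq_ricContr, ricContr_apply, smul_eq_mul]

end IsMetricOn

/-! ### Charged dust in a coordinate domain -/

/-- The coordinate form of a charged dust domain: a metric with a unit Killing field `Y` and the
Einstein equation `G = μ X ⊗ X + α Y ⊗ Y`, the horizontal part of `X` being a unit timelike
field. -/
structure IsDustOn (h : E → E →L[ℝ] E →L[ℝ] ℝ) (U : Set E) (Y X : E → E) (μ α : E → ℝ) : Prop
    extends IsMetricOn h U where
  smooth_Y : ContDiffOn ℝ ∞ Y U
  smooth_X : ContDiffOn ℝ ∞ X U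
  smooth_μ : ContDiffOn ℝ ∞ μ U
  smooth_α : ContDiffOn ℝ ∞ α U
  killing : ∀ y ∈ U, ∀ u v, h y (covDeriv h Y y u) v + h y u (covDeriv h Y y v) = 0
  unit_Y : ∀ y ∈ U, h y (Y y) (Y y) = 1
  norm_X : ∀ y ∈ U, h y (X y) (X y) = h y (X y) (Y y) ^ 2 - 1
  μ_ne : ∀ y ∈ U, μ y ≠ 0
  einstein : ∀ y ∈ U, ∀ v w, ricci h y v w - scalar h y / 2 * h y v w =
    μ y * (h y (X y) v * h y (X y) w) + α y * (h y (Y y) v * h y (Y y) w)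

namespace IsDustOn

variable {h : E → E →L[ℝ] E →L[ℝ] ℝ} {U : Set E} {Y X : E → E} {μ α : E → ℝ}
  (D : IsDustOn h U Y X μ α)
include D

lemma covDeriv_killing_self {y : E} (hy : y ∈ U) : covDeriv h Y y (Y y) = 0 := by
  refine D.ext_inner hy fun w => ?_
  have dY := differentiableAt_of_contDiffOn D.isOpen D.smooth_Y hy
  have h1 : fderiv ℝ (fun z => h z (Y z) (Y z)) y w = 0 := by
    rw [fderiv_eq_of_eqOn D.isOpen D.unit_Y hy]; simp
  rw [D.fderiv_inner hy dY dY, D.symm y hy _ (Y y)] at h1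
  rw [map_zero, zero_apply]
  linarith [D.killing y hy (Y y) w]

/-- The Einstein endomorphism of charged dust. -/
lemma einsteinEnd_apply {y : E} (hy : y ∈ U) (b : E) :
    (ricciEnd h y - (scalar h y / 2) • ContinuousLinearMap.id ℝ E) b =
      (μ y * h y (X y) b) • X y + (α y * h y (Y y) b) • Y y := by
  refine D.ext_inner hy fun w => ?_
  have h1 := D.einstein y hy b w
  rw [ricci_eq_ricContr, ← D.inner_ricciEnd hy] at h1
  simp only [sub_apply, smul_apply, ContinuousLinearMap.id_apply, map_sub, map_smul, map_add,
    add_apply, smul_eq_mul]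
  linarith

/-- The covariant derivative of the Ricci endomorphism of charged dust, by its field equation. -/
lemma covDerivEnd_ricciEnd {y : E} (hy : y ∈ U) (a b : E) :
    covDerivEnd (christoffel h) (ricciEnd h) y a b =
      (fderiv ℝ (scalar h) y a / 2) • b +
      ((fderiv ℝ μ y a * h y (X y) b + μ y * h y (covDeriv h X y a) b) • X y
      + (μ y * h y (X y) b) • covDeriv h X y a
      + (fderiv ℝ α y a * h y (Y y) b + α y * h y (covDeriv h Y y a) b) • Y y
      + (α y * h y (Y y) b) • covDeriv h Y y a) := by
  have dS := differentiableAt_of_contDiffOn D.isOpen D.contDiffOn_scalar hy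
  have dρ := differentiableAt_of_contDiffOn D.isOpen D.contDiffOn_ricciEnd hy
  have dS' : DifferentiableAt ℝ (fun z => scalar h z / 2) y := by
    simpa only [div_eq_mul_inv] using dS.mul_const (2 : ℝ)⁻¹
  have dI : DifferentiableAt ℝ (fun z => (scalar h z / 2) • ContinuousLinearMap.id ℝ E) y :=
    dS'.smul_const _
  rw [← D.covDerivEnd_smulRight hy (differentiableAt_of_contDiffOn D.isOpen D.smooth_μ hy)
    (differentiableAt_of_contDiffOn D.isOpen D.smooth_X hy)
    (T := fun z => ricciEnd h z - (scalar h z / 2) • ContinuousLinearMap.id ℝ E) (dρ.fun_sub dI)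
    (differentiableAt_of_contDiffOn D.isOpen D.smooth_Y hy)
    (differentiableAt_of_contDiffOn D.isOpen D.smooth_α hy) (fun z hz => D.einsteinEnd_apply hz)]
  simp only [covDerivEnd]
  rw [fderiv_fun_sub dρ dI, fderiv_smul_const dS']
  simp only [add_apply, sub_apply, ContinuousLinearMap.comp_apply, smul_apply,
    ContinuousLinearMap.smulRight_apply, ContinuousLinearMap.id_apply, map_sub, map_smul,
    div_eq_mul_inv, fderiv_mul_const dS, smul_eq_mul]
  module

/-- The fields `μ`, `g(X, Y)` and `X` of charged dust are invariant under the flow of `Y`, and `X`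
is geodesic with conserved density `μ` and with `g(X, Y)` constant along it. The invariance is the
vanishing of the Lie derivative of the Einstein curvature along `Y`, contracted with the horizontal
part of `X`; the rest is the contracted Bianchi identity. -/
theorem dynamics {y : E} (hy : y ∈ U) :
    fderiv ℝ μ y (Y y) = 0 ∧ fderiv ℝ (fun z => h z (X z) (Y z)) y (Y y) = 0 ∧
      covDeriv h X y (Y y) = covDeriv h Y y (X y) ∧
      fderiv ℝ μ y (X y) + μ y * traceL E (covDeriv h X y) = 0 ∧
      fderiv ℝ (fun z => h z (X z) (Y z)) y (X y) = 0 ∧ covDeriv h X y (X y) = 0 := by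
  have dX := differentiableAt_of_contDiffOn D.isOpen D.smooth_X hy
  have dY := differentiableAt_of_contDiffOn D.isOpen D.smooth_Y hy
  have dh := D.differentiableAt hy
  have hYY := D.covDeriv_killing_self hy
  have hK := D.killing y hy
  have hμ := D.μ_ne y hy
  have uY := D.unit_Y y hy
  have nX := D.norm_X y hy
  have sXY := D.symm y hy (X y) (Y y)
  set a : E → ℝ := fun z => h z (X z) (Y z) with ha
  have hXY : h y (X y) (Y y) = a y := rfl
  have da : DifferentiableAt ℝ a y := (dh.clm_apply dX).clm_apply dY
  -- derivatives of `g(X, Y)` and of `g(X, X) = g(X, Y) ^ 2 - 1`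
  have Da : ∀ v, fderiv ℝ a y v = h y (covDeriv h X y v) (Y y) + h y (X y) (covDeriv h Y y v) :=
    fun v => D.fderiv_inner hy dX dY v
  have DX : ∀ v, h y (covDeriv h X y v) (X y) = a y * fderiv ℝ a y v := fun v => by
    have h1 := D.fderiv_inner hy dX dX v
    rw [fderiv_eq_of_eqOn D.isOpen D.norm_X hy, fderiv_sub_const, D.symm y hy (X y)] at h1
    change fderiv ℝ (fun z => a z ^ 2) y v = _ at h1
    rw [fderiv_fun_pow 2 da] at h1
    simp at h1
    linarith
  have hYP : ∀ v, h y (Y y) (covDeriv h Y y v) = 0 := fun v => by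
    have := hK (Y y) v; rw [hYY] at this; simpa using this
  have hPY : ∀ v, h y (covDeriv h Y y v) (Y y) = 0 := fun v => by
    rw [D.symm y hy]; exact hYP v
  have hPX : ∀ v, h y (covDeriv h Y y v) (X y) = - h y v (covDeriv h Y y (X y)) := fun v => by
    linarith [hK v (X y)]
  have hXPX : h y (covDeriv h Y y (X y)) (X y) = 0 := by
    have := hPX (X y); rw [D.symm y hy (X y)] at this; linarith
  -- the vector `W = [Y, X]`
  set W := covDeriv h X y (Y y) - covDeriv h Y y (X y) with hW
  have hWY : h y W (Y y) = fderiv ℝ a y (Y y) := by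
    rw [hW, map_sub, sub_apply, hPY, Da, hYY, map_zero]; ring
  have hWX : h y W (X y) = a y * fderiv ℝ a y (Y y) := by
    rw [hW, map_sub, sub_apply, DX, hXPX]; ring
  -- the Lie derivative of the Einstein curvature along `Y` vanishes
  have L : ∀ b, (fderiv ℝ μ y (Y y) * h y (X y) b + μ y * h y W b) • X y
      + (μ y * h y (X y) b) • W + (fderiv ℝ α y (Y y) * h y (Y y) b) • Y y = 0 := by
    intro b
    have h1 := congrArg (fun T => T b) (D.covDerivEnd_ricciEnd_killing D.smooth_Y D.killing hy)
    simp only [sub_apply, ContinuousLinearMap.comp_apply] at h1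
    rw [D.covDerivEnd_ricciEnd hy, D.fderiv_scalar_killing D.smooth_Y D.killing hy, hYY] at h1
    have h2 := D.einsteinEnd_apply hy b
    have h3 := D.einsteinEnd_apply hy (covDeriv h Y y b)
    simp only [sub_apply, smul_apply, ContinuousLinearMap.id_apply] at h2 h3
    rw [sub_eq_iff_eq_add] at h2 h3
    rw [h2, h3, hYP] at h1
    have h4 : h y (X y) (covDeriv h Y y b) = - h y (covDeriv h Y y (X y)) b := by
      linarith [hK (X y) b]
    simp only [map_add, map_smul, hYY, h4, map_zero, zero_apply] at h1
    rw [← sub_eq_zero] at h1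
    rw [← h1, hW, map_sub, sub_apply]
    module
  have q0 : ∀ v w, fderiv ℝ μ y (Y y) * (h y (X y) v * h y (X y) w)
      + μ y * (h y W v * h y (X y) w + h y (X y) v * h y W w)
      + fderiv ℝ α y (Y y) * (h y (Y y) v * h y (Y y) w) = 0 := fun v w => by
    have := congrArg (fun x => h y x w) (L v)
    simp only [map_add, map_smul, add_apply, smul_apply, smul_eq_mul, map_zero, zero_apply] at this
    linarith
  -- contraction with the horizontal part `X - g(X, Y) Y` of `X`
  have hXX₀ : h y (X y) (X y - a y • Y y) = -1 := by
    rw [map_sub, map_smul, nX, hXY, smul_eq_mul]; ring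
  have hYX₀ : h y (Y y) (X y - a y • Y y) = 0 := by
    rw [map_sub, map_smul, ← sXY, uY, hXY, smul_eq_mul]; ring
  have hWX₀ : h y W (X y - a y • Y y) = 0 := by
    rw [map_sub, map_smul, hWX, hWY, smul_eq_mul]; ring
  have m0 : fderiv ℝ μ y (Y y) = 0 := by
    have := q0 (X y - a y • Y y) (X y - a y • Y y)
    rw [hXX₀, hYX₀, hWX₀] at this
    linarith
  have W0 : W = 0 := by
    have := L (X y - a y • Y y)
    rw [hXX₀, hYX₀, hWX₀, m0] at this
    simpa [hμ] using this
  have a0 : fderiv ℝ a y (Y y) = 0 := by rw [← hWY, W0, map_zero, zero_apply]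
  have α0 : fderiv ℝ α y (Y y) = 0 := by
    have := q0 (Y y) (Y y)
    rw [W0, m0, uY] at this
    simpa using this
  -- the contracted Bianchi identity
  have trP : traceL E (covDeriv h Y y) = 0 := D.traceL_eq_zero_of_skew hy hK
  have B : ∀ b, (fderiv ℝ μ y (X y) + μ y * traceL E (covDeriv h X y)) * h y (X y) b
      + μ y * h y (covDeriv h X y (X y)) b = 0 := by
    intro b
    have h1 := D.div_ricciEnd hy b
      ((fderiv ℝ (scalar h) y).smulRight ((1 / 2 : ℝ) • b)
        + ((fderiv ℝ μ y).smulRight (h y (X y) b • X y)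
        + (((h y).flip b) ∘L covDeriv h X y).smulRight (μ y • X y)
        + (μ y * h y (X y) b) • covDeriv h X y
        + (fderiv ℝ α y).smulRight (h y (Y y) b • Y y)
        + (((h y).flip b) ∘L covDeriv h Y y).smulRight (α y • Y y)
        + (α y * h y (Y y) b) • covDeriv h Y y)) (fun v => by
          rw [D.covDerivEnd_ricciEnd hy]
          simp only [add_apply, smul_apply, ContinuousLinearMap.smulRight_apply,
            ContinuousLinearMap.comp_apply, ContinuousLinearMap.flip_apply]
          module)
    simp only [map_add, map_smul, traceL_smulRight, ContinuousLinearMap.comp_apply,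
      ContinuousLinearMap.flip_apply, hYY, α0, trP, map_zero, smul_eq_mul] at h1
    linarith
  have hXP : h y (X y) (covDeriv h Y y (X y)) = 0 := by rw [D.symm y hy]; exact hXPX
  -- eliminate `X (g(X, Y))` between the `Y` and `X` components, using `g(X, X) = g(X, Y) ^ 2 - 1`
  have B1 := B (Y y)
  have B2 := B (X y)
  have h3 : h y (covDeriv h X y (X y)) (Y y) = fderiv ℝ a y (X y) := by rw [Da, hXP]; ring
  rw [DX, nX, hXY] at B2
  rw [h3, hXY] at B1
  have c0 : fderiv ℝ μ y (X y) + μ y * traceL E (covDeriv h X y) = 0 := by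
    linear_combination a y * B1 - B2
  have aX0 : fderiv ℝ a y (X y) = 0 := by
    rw [c0] at B1; simpa [hμ] using B1
  refine ⟨m0, a0, sub_eq_zero.1 W0, c0, aX0, D.ext_inner hy fun b => ?_⟩
  have := B b
  rw [c0] at this
  simpa [hμ] using this

end IsDustOn

end CoordGeom

namespace CoordGeom

/-! ### The visible field of charged dust in a coordinate domain -/

variable {E : Type*} [NormedAddCommGroup E] [NormedSpace ℝ E]

namespace IsDustOn

variable [FiniteDimensional ℝ E]
variable {h : E → E →L[ℝ] E →L[ℝ] ℝ} {U : Set E} {Y X : E → E} {μ α : E → ℝ}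
  (D : IsDustOn h U Y X μ α)
include D

lemma contDiffOn_inner_XY : ContDiffOn ℝ ∞ (fun z => h z (X z) (Y z)) U :=
  (D.smooth.clm_apply D.smooth_X).clm_apply D.smooth_Y

lemma contDiffOn_visible : ContDiffOn ℝ ∞ (fun z => X z - h z (X z) (Y z) • Y z) U :=
  D.smooth_X.sub (D.contDiffOn_inner_XY.smul D.smooth_Y)

/-- The covariant derivative of the visible field `X - g(X, Y) Y`. -/
lemma covDeriv_visible {y : E} (hy : y ∈ U) (v : E) :
    covDeriv h (fun z => X z - h z (X z) (Y z) • Y z) y v =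
      covDeriv h X y v - fderiv ℝ (fun z => h z (X z) (Y z)) y v • Y y
        - h y (X y) (Y y) • covDeriv h Y y v := by
  have dX := differentiableAt_of_contDiffOn D.isOpen D.smooth_X hy
  have dY := differentiableAt_of_contDiffOn D.isOpen D.smooth_Y hy
  have da := differentiableAt_of_contDiffOn D.isOpen D.contDiffOn_inner_XY hy
  simp only [covDeriv]
  rw [fderiv_fun_sub dX (da.fun_smul dY), fderiv_fun_smul da dY]
  simp only [add_apply, sub_apply, smul_apply, ContinuousLinearMap.smulRight_apply,
    ContinuousLinearMap.flip_apply, map_sub, map_smul]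
  module

/-- The divergence of a multiple of the visible field: the vertical part of `X` does not contribute,
since `Y` is divergence-free and `g(X, Y)` is constant along `Y`. -/
lemma div_smul_visible {f : E → ℝ} {y : E} (hy : y ∈ U) (df : DifferentiableAt ℝ f y) :
    traceL E (covDeriv h (fun z => f z • (X z - h z (X z) (Y z) • Y z)) y) =
      fderiv ℝ f y (X y) - h y (X y) (Y y) * fderiv ℝ f y (Y y)
        + f y * traceL E (covDeriv h X y) := by
  have dV := differentiableAt_of_contDiffOn D.isOpen D.contDiffOn_visible hy
  have h1 : covDeriv h (fun z => f z • (X z - h z (X z) (Y z) • Y z)) y =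
      (fderiv ℝ f y).smulRight (X y - h y (X y) (Y y) • Y y)
      + f y • (covDeriv h X y - (fderiv ℝ (fun z => h z (X z) (Y z)) y).smulRight (Y y)
        - h y (X y) (Y y) • covDeriv h Y y) := by
    ext v
    have h2 := D.covDeriv_visible hy v
    simp only [covDeriv] at h2 ⊢
    rw [fderiv_fun_smul df dV]
    simp only [add_apply, sub_apply, smul_apply, ContinuousLinearMap.smulRight_apply,
      ContinuousLinearMap.flip_apply, map_smul] at h2 ⊢
    rw [← h2]
    module
  rw [h1]
  simp only [map_add, map_sub, map_smul, traceL_smulRight, smul_eq_mul,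
    (D.dynamics hy).2.1, D.traceL_eq_zero_of_skew hy (D.killing y hy)]
  ring

/-- Conservation of mass. -/
theorem div_mass {y : E} (hy : y ∈ U) :
    traceL E (covDeriv h (fun z => μ z • (X z - h z (X z) (Y z) • Y z)) y) = 0 := by
  obtain ⟨m0, -, -, c0, -, -⟩ := D.dynamics hy
  rw [D.div_smul_visible hy (differentiableAt_of_contDiffOn D.isOpen D.smooth_μ hy), m0]
  linarith

/-- The ratio of charge to mass is constant along the visible field. -/
theorem fderiv_inner_XY_visible {y : E} (hy : y ∈ U) :
    fderiv ℝ (fun z => h z (X z) (Y z)) y (X y - h y (X y) (Y y) • Y y) = 0 := by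
  obtain ⟨-, a0, -, -, aX0, -⟩ := D.dynamics hy
  rw [map_sub, map_smul, a0, aX0, smul_zero, sub_zero]

/-- Conservation of charge; the charge density is `-μ g(X, Y)`. -/
theorem div_charge {y : E} (hy : y ∈ U) :
    traceL E (covDeriv h (fun z =>
      (-(μ z * h z (X z) (Y z))) • (X z - h z (X z) (Y z) • Y z)) y) = 0 := by
  obtain ⟨m0, a0, -, c0, aX0, -⟩ := D.dynamics hy
  have dμ := differentiableAt_of_contDiffOn D.isOpen D.smooth_μ hy
  have da := differentiableAt_of_contDiffOn D.isOpen D.contDiffOn_inner_XY hy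
  rw [D.div_smul_visible hy (dμ.fun_mul da).fun_neg, fderiv_fun_neg, fderiv_fun_mul dμ da]
  simp only [neg_apply, add_apply, smul_apply, smul_eq_mul, m0, a0, aX0]
  linear_combination (- h y (X y) (Y y)) * c0

/-- The acceleration of the visible field. -/
theorem covDeriv_visible_self {y : E} (hy : y ∈ U) :
    covDeriv h (fun z => X z - h z (X z) (Y z) • Y z) y (X y - h y (X y) (Y y) • Y y) =
      (-2 * h y (X y) (Y y)) • covDeriv h Y y (X y) := by
  obtain ⟨-, -, hW, -, -, hX⟩ := D.dynamics hy
  rw [D.covDeriv_visible hy, D.fderiv_inner_XY_visible hy]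
  simp only [map_sub, map_smul, hW, hX, D.covDeriv_killing_self hy]
  module

end IsDustOn

/-! ### Change of coordinates -/

/-- `φ` is an isometric local diffeomorphism from the metric `h'` on `V` to the metric `h` on `U`. -/
structure IsIsometryOn (φ : E → E) (h' : E → E →L[ℝ] E →L[ℝ] ℝ) (V : Set E)
    (h : E → E →L[ℝ] E →L[ℝ] ℝ) (U : Set E) : Prop where
  source : IsMetricOn h' V
  target : IsMetricOn h U
  smooth : ContDiffOn ℝ ∞ φ V
  mapsTo : Set.MapsTo φ V U
  invertible : ∀ z ∈ V, (fderiv ℝ φ z).IsInvertible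
  isometry : ∀ z ∈ V, ∀ u v, h' z u v = h (φ z) (fderiv ℝ φ z u) (fderiv ℝ φ z v)

namespace IsIsometryOn

variable {φ : E → E} {h' : E → E →L[ℝ] E →L[ℝ] ℝ} {V : Set E}
    {h : E → E →L[ℝ] E →L[ℝ] ℝ} {U : Set E} (I : IsIsometryOn φ h' V h U)
include I

lemma hasFDerivAt {y : E} (hy : y ∈ V) : HasFDerivAt φ (fderiv ℝ φ y) y :=
  (differentiableAt_of_contDiffOn I.source.isOpen I.smooth hy).hasFDerivAt

lemma differentiableAt_fderiv {y : E} (hy : y ∈ V) : DifferentiableAt ℝ (fderiv ℝ φ) y :=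
  differentiableAt_of_contDiffOn I.source.isOpen (contDiffOn_fderiv I.source.isOpen I.smooth) hy

lemma fderiv_comp_apply {F : Type*} [NormedAddCommGroup F] [NormedSpace ℝ F] {f : E → F} {y : E}
    (hy : y ∈ V) (hf : DifferentiableAt ℝ f (φ y)) (a : E) :
    fderiv ℝ (fun z => f (φ z)) y a = fderiv ℝ f (φ y) (fderiv ℝ φ y a) :=
  congrArg (fun L => L a) (hf.hasFDerivAt.comp y (I.hasFDerivAt hy)).fderiv

/-- The transformation law of the Christoffel map. -/
lemma christoffel_eq {y : E} (hy : y ∈ V) (u v : E) :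
    fderiv ℝ φ y (christoffel h' y u v) = fderiv ℝ (fderiv ℝ φ) y u v
      + christoffel h (φ y) (fderiv ℝ φ y u) (fderiv ℝ φ y v) := by
  have hy' := I.mapsTo hy
  have dh := I.target.differentiableAt hy'
  have dφ := (I.hasFDerivAt hy).differentiableAt
  have dφ' := I.differentiableAt_fderiv hy
  have key : ∀ a u v, fderiv ℝ h' y a u v =
      fderiv ℝ h (φ y) (fderiv ℝ φ y a) (fderiv ℝ φ y u) (fderiv ℝ φ y v)
      + h (φ y) (fderiv ℝ (fderiv ℝ φ) y a u) (fderiv ℝ φ y v)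
      + h (φ y) (fderiv ℝ φ y u) (fderiv ℝ (fderiv ℝ φ) y a v) := by
    intro a u v
    have dh' := I.source.differentiableAt hy
    rw [← fderiv_clm_apply_const dh', ← fderiv_clm_apply_const
      (dh'.clm_apply (differentiableAt_const u)),
      fderiv_eq_of_eqOn I.source.isOpen (fun z hz => I.isometry z hz u v) hy,
      fderiv_form_apply (β := fun z => h (φ z)) (dh.fun_comp' y dφ)
        (dφ'.clm_apply (differentiableAt_const u)) (dφ'.clm_apply (differentiableAt_const v)),
      I.fderiv_comp_apply hy dh, fderiv_clm_apply_const dφ', fderiv_clm_apply_const dφ']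
  refine I.target.ext_inner hy' fun w => ?_
  obtain ⟨w, rfl⟩ := (I.invertible y hy).surjective w
  have s := snd_fderiv_symm I.source.isOpen I.smooth hy
  rw [← I.isometry y hy, I.source.inner_christoffel hy, map_add, add_apply,
    I.target.inner_christoffel hy', key, key, key, s v u, s w u, s w v,
    I.target.symm _ hy' (fderiv ℝ φ y v), I.target.symm _ hy' (fderiv ℝ φ y u)]
  ring

/-- The transformation law of covariant derivatives. -/
lemma covDeriv_eq {Z' Z : E → E} {y : E} (hy : y ∈ V) (dZ' : DifferentiableAt ℝ Z' y)
    (dZ : DifferentiableAt ℝ Z (φ y)) (hZ : ∀ z ∈ V, fderiv ℝ φ z (Z' z) = Z (φ z)) (v : E) :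
    fderiv ℝ φ y (covDeriv h' Z' y v) = covDeriv h Z (φ y) (fderiv ℝ φ y v) := by
  have h1 := congrArg (fun L => L v) (fderiv_eq_of_eqOn I.source.isOpen hZ hy)
  simp only [fderiv_clm_apply_apply (I.differentiableAt_fderiv hy) dZ',
    I.fderiv_comp_apply hy dZ] at h1
  simp only [covDeriv, add_apply, map_add, ContinuousLinearMap.flip_apply, I.christoffel_eq hy,
    hZ y hy, ← h1]
  abel

/-- The exterior derivative of 1-forms is natural. -/
lemma extDeriv_eq {β' β : E → E →L[ℝ] ℝ} {y : E} (hy : y ∈ V) (dβ' : DifferentiableAt ℝ β' y)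
    (dβ : DifferentiableAt ℝ β (φ y)) (hβ : ∀ z ∈ V, ∀ v, β' z v = β (φ z) (fderiv ℝ φ z v))
    (u v : E) :
    fderiv ℝ β' y u v - fderiv ℝ β' y v u =
      fderiv ℝ β (φ y) (fderiv ℝ φ y u) (fderiv ℝ φ y v)
        - fderiv ℝ β (φ y) (fderiv ℝ φ y v) (fderiv ℝ φ y u) := by
  have dφ := (I.hasFDerivAt hy).differentiableAt
  have dφ' := I.differentiableAt_fderiv hy
  have key : ∀ u v, fderiv ℝ β' y u v = fderiv ℝ β (φ y) (fderiv ℝ φ y u) (fderiv ℝ φ y v)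
      + β (φ y) (fderiv ℝ (fderiv ℝ φ) y u v) := fun u v => by
    rw [← fderiv_clm_apply_const dβ', fderiv_eq_of_eqOn I.source.isOpen (fun z hz => hβ z hz v) hy,
      fderiv_clm_apply_apply (c := fun z => β (φ z)) (dβ.fun_comp' y dφ)
        (dφ'.clm_apply (differentiableAt_const v)),
      I.fderiv_comp_apply hy dβ, fderiv_clm_apply_const dφ']
  rw [key, key, snd_fderiv_symm I.source.isOpen I.smooth hy u v]
  ring

variable [FiniteDimensional ℝ E]

/-- The curvature is natural. -/
lemma curv_eq {y : E} (hy : y ∈ V) (u v w : E) :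
    fderiv ℝ φ y (curv (christoffel h') y u v w) =
      curv (christoffel h) (φ y) (fderiv ℝ φ y u) (fderiv ℝ φ y v) (fderiv ℝ φ y w) := by
  have hy' := I.mapsTo hy
  have dA' := differentiableAt_of_contDiffOn I.source.isOpen I.source.contDiffOn_christoffel hy
  have dA := differentiableAt_of_contDiffOn I.target.isOpen I.target.contDiffOn_christoffel hy'
  have dφ := (I.hasFDerivAt hy).differentiableAt
  have dφ' := I.differentiableAt_fderiv hy
  have sφ' := contDiffOn_fderiv I.source.isOpen I.smooth
  have dφ'' := differentiableAt_of_contDiffOn I.source.isOpen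
    (contDiffOn_fderiv I.source.isOpen sφ') hy
  -- the derivative of the transformation law of the Christoffel map
  have key : ∀ u v w, fderiv ℝ φ y (fderiv ℝ (christoffel h') y u v w) =
      fderiv ℝ (fderiv ℝ (fderiv ℝ φ)) y u v w
      + fderiv ℝ (christoffel h) (φ y) (fderiv ℝ φ y u) (fderiv ℝ φ y v) (fderiv ℝ φ y w)
      + christoffel h (φ y) (fderiv ℝ (fderiv ℝ φ) y u v) (fderiv ℝ φ y w)
      + christoffel h (φ y) (fderiv ℝ φ y v) (fderiv ℝ (fderiv ℝ φ) y u w)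
      - fderiv ℝ (fderiv ℝ φ) y u (christoffel h' y v w) := by
    intro u v w
    have c : ∀ v : E, DifferentiableAt ℝ (fun z => fderiv ℝ φ z v) y :=
      fun v => dφ'.clm_apply (differentiableAt_const v)
    have d1 := dA'.clm_apply (differentiableAt_const v)
    have d2 := d1.clm_apply (differentiableAt_const w)
    have d3 := dφ''.clm_apply (differentiableAt_const v)
    have d4 := d3.clm_apply (differentiableAt_const w)
    have d5 : DifferentiableAt ℝ (fun z => christoffel h (φ z)) y := dA.fun_comp' y dφ
    have h1 := congrArg (fun L => L u)
      (fderiv_eq_of_eqOn I.source.isOpen (fun z hz => I.christoffel_eq hz v w) hy)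
    simp only [fderiv_clm_apply_apply dφ' d2, fderiv_clm_apply_const d1,
      fderiv_clm_apply_const dA'] at h1
    rw [fderiv_fun_add d4 ((d5.clm_apply (c v)).clm_apply (c w)), add_apply,
      fderiv_clm_apply_const d3, fderiv_clm_apply_const dφ'',
      fderiv_form_apply (β := fun z => christoffel h (φ z)) d5 (c v) (c w),
      I.fderiv_comp_apply hy dA, fderiv_clm_apply_const dφ', fderiv_clm_apply_const dφ'] at h1
    rw [eq_sub_iff_add_eq, add_comm, h1]
    abel
  simp only [curv_apply, add_apply, sub_apply, ContinuousLinearMap.comp_apply, map_add, map_sub,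
    key, I.christoffel_eq hy]
  rw [snd_fderiv_symm I.source.isOpen sφ' hy u v, snd_fderiv_symm I.source.isOpen I.smooth hy u v]
  abel

/-- The Ricci form is natural. -/
lemma ricci_eq {y : E} (hy : y ∈ V) (v w : E) :
    ricci h' y v w = ricci h (φ y) (fderiv ℝ φ y v) (fderiv ℝ φ y w) := by
  obtain ⟨e, he⟩ := I.invertible y hy
  have key : ((curv (christoffel h') y).flip v).flip w = (e.symm : E →L[ℝ] E) ∘L
      (((curv (christoffel h) (φ y)).flip (fderiv ℝ φ y v)).flip (fderiv ℝ φ y w)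
        ∘L fderiv ℝ φ y) := by
    ext u
    simp only [ContinuousLinearMap.flip_apply, ContinuousLinearMap.comp_apply, ← I.curv_eq hy]
    rw [← he]; simp
  rw [ricci_eq_ricContr, ricci_eq_ricContr, ricContr_apply, ricContr_apply, key, traceL_comp_comm,
    ContinuousLinearMap.comp_assoc, ← he]
  simp

/-- The scalar curvature is natural. -/
lemma scalar_eq {y : E} (hy : y ∈ V) : scalar h' y = scalar h (φ y) := by
  obtain ⟨e, he⟩ := I.invertible y hy
  have key : ricciEnd h' y = (e.symm : E →L[ℝ] E) ∘L (ricciEnd h (φ y) ∘L fderiv ℝ φ y) := by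
    ext u
    refine I.source.ext_inner hy fun w => ?_
    rw [I.source.inner_ricciEnd hy, ← ricci_eq_ricContr, I.ricci_eq hy, ricci_eq_ricContr,
      ← I.target.inner_ricciEnd (I.mapsTo hy), I.isometry y hy, ← he]
    simp
  rw [CoordGeom.scalar_eq, CoordGeom.scalar_eq, key, traceL_comp_comm,
    ContinuousLinearMap.comp_assoc, ← he]
  simp

end IsIsometryOn

/-- A nondegenerate bilinear form on a finite-dimensional space is invertible. -/
lemma isInvertible_of_nondegenerate [FiniteDimensional ℝ E] (β : E →L[ℝ] E →L[ℝ] ℝ)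
    (hβ : ∀ u, (∀ v, β u v = 0) → u = 0) : β.IsInvertible := by
  have hinj : Function.Injective (β : E →ₗ[ℝ] E →L[ℝ] ℝ) := by
    rw [injective_iff_map_eq_zero]
    exact fun u hu => hβ u fun v => congrArg (fun L => L v) hu
  have hrank : Module.finrank ℝ E = Module.finrank ℝ (E →L[ℝ] ℝ) := by
    rw [← (LinearMap.toContinuousLinearMap (𝕜 := ℝ) (E := E) (F' := ℝ)).finrank_eq,
      Subspace.dual_finrank_eq]
  exact ⟨(LinearEquiv.ofInjectiveOfFinrankEq _ hinj hrank).toContinuousLinearEquiv, by ext; rfl⟩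

end CoordGeom

section Manifold

/-! ### Tensor fields read in a chart -/

variable {n : ℕ} {M : Type*} [TopologicalSpace M] [ChartedSpace (EuclideanSpace ℝ (Fin n)) M]

lemma coordForm_apply (β : Π x : M, TangentSpace (𝓡 n) x →L[ℝ] TangentSpace (𝓡 n) x →L[ℝ] ℝ)
    (x : M) (y u v : EuclideanSpace ℝ (Fin n)) :
    coordForm β x y u v = β ((extChartAt (𝓡 n) x).symm y) (ofCoord x y u) (ofCoord x y v) := rfl

lemma coordOneForm_apply (α : Π x : M, TangentSpace (𝓡 n) x →L[ℝ] ℝ)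
    (x : M) (y u : EuclideanSpace ℝ (Fin n)) :
    coordOneForm α x y u = α ((extChartAt (𝓡 n) x).symm y) (ofCoord x y u) := rfl

/-! ### Change of charts -/

/-- The coordinate change from the chart at `x` to the chart at `x'`. -/
def coordChange (x x' : M) (y : EuclideanSpace ℝ (Fin n)) : EuclideanSpace ℝ (Fin n) :=
  extChartAt (𝓡 n) x' ((extChartAt (𝓡 n) x).symm y)

/-- The domain of the coordinate change from the chart at `x` to the chart at `x'`. -/
def overlap (x x' : M) : Set (EuclideanSpace ℝ (Fin n)) :=
  (extChartAt (𝓡 n) x).target ∩ (extChartAt (𝓡 n) x).symm ⁻¹' (extChartAt (𝓡 n) x').source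

lemma isOpen_preimage_extChartAt_symm (x : M) {Ω : Set M} (hΩ : IsOpen Ω) :
    IsOpen ((extChartAt (𝓡 n) x).target ∩ (extChartAt (𝓡 n) x).symm ⁻¹' Ω) :=
  (continuousOn_extChartAt_symm x).isOpen_inter_preimage (isOpen_extChartAt_target x) hΩ

lemma isOpen_overlap (x x' : M) : IsOpen (overlap (n := n) x x') :=
  isOpen_preimage_extChartAt_symm x (isOpen_extChartAt_source x')

lemma mapsTo_coordChange (x x' : M) :
    Set.MapsTo (coordChange (n := n) x x') (overlap x x') (extChartAt (𝓡 n) x').target :=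
  fun _ hz => (extChartAt (𝓡 n) x').map_source hz.2

lemma extChartAt_symm_coordChange {x x' : M} {z : EuclideanSpace ℝ (Fin n)}
    (hz : z ∈ overlap x x') :
    (extChartAt (𝓡 n) x').symm (coordChange x x' z) = (extChartAt (𝓡 n) x).symm z :=
  (extChartAt (𝓡 n) x').left_inv hz.2

lemma form_congr (β : Π x : M, TangentSpace (𝓡 n) x →L[ℝ] TangentSpace (𝓡 n) x →L[ℝ] ℝ)
    {p q : M} (h : p = q) (u v : EuclideanSpace ℝ (Fin n)) : β p u v = β q u v := by subst h; rfl

lemma oneForm_congr (α : Π x : M, TangentSpace (𝓡 n) x →L[ℝ] ℝ)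
    {p q : M} (h : p = q) (u : EuclideanSpace ℝ (Fin n)) : α p u = α q u := by subst h; rfl

lemma mem_overlap_self {x : M} {y : EuclideanSpace ℝ (Fin n)}
    (hy : y ∈ (extChartAt (𝓡 n) x).target) :
    y ∈ overlap x ((extChartAt (𝓡 n) x).symm y) :=
  ⟨hy, mem_extChartAt_source _⟩

lemma mem_target_of_mem {x : M} {Ω : Set M} (hx : x ∈ Ω) :
    extChartAt (𝓡 n) x x ∈ (extChartAt (𝓡 n) x).target ∩ (extChartAt (𝓡 n) x).symm ⁻¹' Ω :=
  ⟨mem_extChartAt_target x, by rwa [Set.mem_preimage, extChartAt_to_inv]⟩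

lemma coordField_smul (f : M → ℝ) (V : Π x : M, TangentSpace (𝓡 n) x) (x : M)
    (y : EuclideanSpace ℝ (Fin n)) :
    coordField (fun z => f z • V z) x y = f ((extChartAt (𝓡 n) x).symm y) • coordField V x y :=
  (ofCoord x y).inverse.map_smul _ _

variable [IsManifold (𝓡 n) ∞ M]

lemma mdifferentiableAt_extChartAt_symm' {x : M} {y : EuclideanSpace ℝ (Fin n)}
    (hy : y ∈ (extChartAt (𝓡 n) x).target) :
    MDifferentiableAt 𝓘(ℝ, EuclideanSpace ℝ (Fin n)) (𝓡 n) (extChartAt (𝓡 n) x).symm y := by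
  have h := mdifferentiableWithinAt_extChartAt_symm (I := 𝓡 n) hy
  rwa [ModelWithCorners.range_eq_univ, mdifferentiableWithinAt_univ] at h

lemma isInvertible_ofCoord {x : M} {y : EuclideanSpace ℝ (Fin n)}
    (hy : y ∈ (extChartAt (𝓡 n) x).target) : (ofCoord (n := n) x y).IsInvertible := by
  have h := isInvertible_mfderivWithin_extChartAt_symm (I := 𝓡 n) hy
  rwa [ModelWithCorners.range_eq_univ, mfderivWithin_univ] at h

/-- The tangent space at `x` is modelled by the preferred chart at `x`, in which `toCoord x` is the
identity. -/
lemma toCoord_apply (x : M) (v : TangentSpace (𝓡 n) x) :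
    toCoord x v = (v : EuclideanSpace ℝ (Fin n)) := by
  rw [toCoord, mfderiv_extChartAt_self]; rfl

lemma ofCoord_self (x : M) : (ofCoord x (extChartAt (𝓡 n) x x)) =
    ContinuousLinearMap.id ℝ (EuclideanSpace ℝ (Fin n)) := by
  rw [ofCoord, ← mfderivWithin_univ, ← ModelWithCorners.range_eq_univ (𝓡 n)]
  exact mfderivWithin_range_extChartAt_symm

lemma ofCoord_coordField (V : Π x : M, TangentSpace (𝓡 n) x) {x : M}
    {y : EuclideanSpace ℝ (Fin n)} (hy : y ∈ (extChartAt (𝓡 n) x).target) :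
    ofCoord x y (coordField V x y) = V ((extChartAt (𝓡 n) x).symm y) :=
  (isInvertible_ofCoord hy).self_apply_inverse _

lemma contDiffOn_comp_extChartAt_symm {f : M → ℝ} {Ω : Set M}
    (hf : ContMDiffOn (𝓡 n) 𝓘(ℝ, ℝ) ∞ f Ω) (x : M) :
    ContDiffOn ℝ ∞ (fun y => f ((extChartAt (𝓡 n) x).symm y))
      ((extChartAt (𝓡 n) x).target ∩ (extChartAt (𝓡 n) x).symm ⁻¹' Ω) := by
  rw [← contMDiffOn_iff_contDiffOn]
  exact hf.comp ((contMDiffOn_extChartAt_symm x).mono Set.inter_subset_left) Set.inter_subset_right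

lemma contDiffOn_coordField {V : Π x : M, TangentSpace (𝓡 n) x} {Ω : Set M}
    (hV : SmoothFieldOn V Ω) (x : M) :
    ContDiffOn ℝ ∞ (coordField V x)
      ((extChartAt (𝓡 n) x).target ∩ (extChartAt (𝓡 n) x).symm ⁻¹' Ω) := by
  refine contMDiffOn_vectorSpace_iff_contDiffOn.1 fun y hy => ?_
  have hs : ContMDiffAt 𝓘(ℝ, EuclideanSpace ℝ (Fin n)) (𝓡 n) ∞ (extChartAt (𝓡 n) x).symm y :=
    (contMDiffOn_extChartAt_symm x).contMDiffAt ((isOpen_extChartAt_target x).mem_nhds hy.1)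
  exact (ContMDiffWithinAt.mpullback_vectorField_preimage (hV _ hy.2) hs
    (isInvertible_ofCoord hy.1) (by simp)).mono Set.inter_subset_right

/-- The coordinate vector fields of a chart are smooth. -/
lemma contMDiffOn_ofCoord (x : M) (u : EuclideanSpace ℝ (Fin n)) :
    ContMDiffOn 𝓘(ℝ, EuclideanSpace ℝ (Fin n)) (𝓡 n).tangent ∞
      (fun y => (⟨(extChartAt (𝓡 n) x).symm y, ofCoord x y u⟩ : TangentBundle (𝓡 n) M))
      (extChartAt (𝓡 n) x).target := by
  have ho := isOpen_extChartAt_target (I := 𝓡 n) x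
  have h1 := (contMDiffOn_extChartAt_symm (I := 𝓡 n) (n := ∞) x).contMDiffOn_tangentMapWithin
    (m := ∞) (by simp) ho.uniqueMDiffOn
  have h2 : ContMDiffOn 𝓘(ℝ, EuclideanSpace ℝ (Fin n)) (𝓘(ℝ, EuclideanSpace ℝ (Fin n))).tangent ∞
      (fun y => (⟨y, u⟩ : TangentBundle 𝓘(ℝ, EuclideanSpace ℝ (Fin n)) (EuclideanSpace ℝ (Fin n))))
      (extChartAt (𝓡 n) x).target :=
    contMDiffOn_vectorSpace_iff_contDiffOn.2 contDiffOn_const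
  refine (h1.comp h2 fun y hy => hy).congr fun y hy => ?_
  simp only [Function.comp_apply, tangentMapWithin, mfderivWithin_of_isOpen ho hy]
  rfl

/-- The inner product of two smooth fields along a smooth map is smooth. -/
lemma LorentzianMetric.contMDiffOn_inner (g : LorentzianMetric n M)
    {E' : Type*} [NormedAddCommGroup E'] [NormedSpace ℝ E'] {H' : Type*} [TopologicalSpace H']
    {I' : ModelWithCorners ℝ E' H'} {N : Type*} [TopologicalSpace N] [ChartedSpace H' N]
    {s : Set N} {b : N → M} {v w : Π z, TangentSpace (𝓡 n) (b z)}
    (hv : ContMDiffOn I' (𝓡 n).tangent ∞ (fun z => (⟨b z, v z⟩ : TangentBundle (𝓡 n) M)) s)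
    (hw : ContMDiffOn I' (𝓡 n).tangent ∞ (fun z => (⟨b z, w z⟩ : TangentBundle (𝓡 n) M)) s) :
    ContMDiffOn I' 𝓘(ℝ, ℝ) ∞ (fun z => g.inner (b z) (v z) (w z)) s := by
  intro x hx
  have hb : ContMDiffWithinAt I' (𝓡 n) ∞ b s x := by
    have := hv x hx
    rw [Bundle.contMDiffWithinAt_totalSpace] at this
    exact this.1
  have : ContMDiffWithinAt I' ((𝓡 n).prod 𝓘(ℝ)) ∞
      (fun m => Bundle.TotalSpace.mk' ℝ (E := Bundle.Trivial M ℝ) (b m)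
        (g.inner (b m) (v m) (w m))) s x := by
    apply ContMDiffWithinAt.clm_bundle_apply₂ (F₁ := EuclideanSpace ℝ (Fin n))
      (F₂ := EuclideanSpace ℝ (Fin n))
    · exact ContMDiffAt.comp_contMDiffWithinAt x g.contMDiff.contMDiffAt hb
    · exact hv x hx
    · exact hw x hx
  rw [Bundle.contMDiffWithinAt_totalSpace] at this
  exact this.2

namespace LorentzianMetric

variable (g : LorentzianMetric n M)

lemma nondegenerate (x : M) (u : TangentSpace (𝓡 n) x) (hu : ∀ v, g.inner x u v = 0) : u = 0 := by
  obtain ⟨b, hb⟩ := g.lorentzian x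
  rw [← b.sum_repr u]
  refine Finset.sum_eq_zero fun j _ => ?_
  have h1 := hu (b j)
  rw [← b.sum_repr u] at h1
  simp only [map_sum, map_smul, sum_apply, smul_apply, hb, smul_eq_mul] at h1
  rw [Finset.sum_eq_single j (fun i _ hij => by simp [hij]) (by simp)] at h1
  have h2 : b.repr u j = 0 := by
    by_cases h : (j : ℕ) = 0 <;> simpa [h] using h1
  rw [h2, zero_smul]

lemma inner_inverse (x : M) (φ : TangentSpace (𝓡 n) x →L[ℝ] ℝ) (w : TangentSpace (𝓡 n) x) :
    g.inner x ((g.inner x).inverse φ) w = φ w := by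
  have h : (g.inner x).IsInvertible := CoordGeom.isInvertible_of_nondegenerate
    (E := EuclideanSpace ℝ (Fin n)) (g.inner x) (g.nondegenerate x)
  rw [h.self_apply_inverse]

lemma ext_inner {x : M} {u v : TangentSpace (𝓡 n) x} (h : ∀ w, g.inner x u w = g.inner x v w) :
    u = v := by
  rw [← sub_eq_zero]
  exact g.nondegenerate x _ fun w => by rw [map_sub, sub_apply, h, sub_self]

/-- The coordinate expression of a Lorentzian metric. -/
lemma isMetricOn_coordForm (x : M) :
    CoordGeom.IsMetricOn (coordForm g.inner x) (extChartAt (𝓡 n) x).target where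
  isOpen := isOpen_extChartAt_target x
  smooth := by
    refine contDiffOn_clm_apply.2 fun u => contDiffOn_clm_apply.2 fun v => ?_
    rw [← contMDiffOn_iff_contDiffOn]
    exact g.contMDiffOn_inner (contMDiffOn_ofCoord x u) (contMDiffOn_ofCoord x v)
  symm y _ u v := g.symm _ _ _
  invertible y hy := by
    refine CoordGeom.isInvertible_of_nondegenerate _ fun u hu => ?_
    obtain ⟨e, he⟩ := isInvertible_ofCoord hy
    have h1 : ofCoord x y u = 0 := g.nondegenerate _ _ fun v => by
      have := hu (e.symm v)
      rw [coordForm_apply, ← he, ContinuousLinearEquiv.coe_coe, e.apply_symm_apply] at this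
      rwa [← he]
    rw [← he] at h1
    exact e.injective (h1.trans (map_zero e).symm)

end LorentzianMetric

/-! ### Naturality under changes of charts -/

lemma contDiffOn_coordChange (x x' : M) : ContDiffOn ℝ ∞ (coordChange (n := n) x x')
    (overlap x x') := by
  have h := contDiffOn_ext_coord_change (I := 𝓡 n) (n := ∞) x' x
  rwa [PartialEquiv.trans_source, PartialEquiv.symm_source] at h

/-- The coordinate frames of two charts are related by the derivative of the coordinate change. -/
lemma ofCoord_eq {x x' : M} {z : EuclideanSpace ℝ (Fin n)} (hz : z ∈ overlap x x')
    (u : EuclideanSpace ℝ (Fin n)) :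
    (ofCoord x z u : EuclideanSpace ℝ (Fin n)) =
      ofCoord x' (coordChange x x' z) (fderiv ℝ (coordChange x x') z u) := by
  have h1 : (extChartAt (𝓡 n) x).symm =ᶠ[nhds z]
      (extChartAt (𝓡 n) x').symm ∘ coordChange (n := n) x x' := by
    filter_upwards [(isOpen_overlap x x').mem_nhds hz] with w hw
    exact (extChartAt_symm_coordChange hw).symm
  have h2 : DifferentiableAt ℝ (coordChange (n := n) x x') z :=
    CoordGeom.differentiableAt_of_contDiffOn (isOpen_overlap x x') (contDiffOn_coordChange x x') hz
  have h3 := mfderiv_comp_apply z (mdifferentiableAt_extChartAt_symm' (mapsTo_coordChange x x' hz))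
    h2.mdifferentiableAt u
  rw [mfderiv_eq_fderiv] at h3
  rw [ofCoord, h1.mfderiv_eq]
  exact h3

lemma isInvertible_fderiv_coordChange {x x' : M} {z : EuclideanSpace ℝ (Fin n)}
    (hz : z ∈ overlap x x') : (fderiv ℝ (coordChange (n := n) x x') z).IsInvertible := by
  have h1 : fderiv ℝ (coordChange (n := n) x x') z =
      (ofCoord x' (coordChange x x' z)).inverse ∘L (ofCoord x z :
        EuclideanSpace ℝ (Fin n) →L[ℝ] EuclideanSpace ℝ (Fin n)) := by
    ext1 u
    change _ = (ofCoord x' (coordChange x x' z)).inverse (ofCoord x z u : EuclideanSpace ℝ (Fin n))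
    rw [ofCoord_eq hz]
    exact ((isInvertible_ofCoord (mapsTo_coordChange x x' hz)).inverse_apply_self _).symm
  rw [h1]
  exact (isInvertible_ofCoord (mapsTo_coordChange x x' hz)).inverse.comp
    (isInvertible_ofCoord hz.1)

lemma coordForm_eq (β : Π x : M, TangentSpace (𝓡 n) x →L[ℝ] TangentSpace (𝓡 n) x →L[ℝ] ℝ)
    {x x' : M} {z : EuclideanSpace ℝ (Fin n)} (hz : z ∈ overlap x x')
    (u v : EuclideanSpace ℝ (Fin n)) :
    coordForm β x z u v = coordForm β x' (coordChange x x' z)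
      (fderiv ℝ (coordChange x x') z u) (fderiv ℝ (coordChange x x') z v) := by
  rw [coordForm_apply, coordForm_apply]
  have := form_congr β (extChartAt_symm_coordChange hz).symm (ofCoord x z u) (ofCoord x z v)
  rw [ofCoord_eq hz, ofCoord_eq hz v] at this
  rw [← this, ← ofCoord_eq hz, ← ofCoord_eq hz v]

lemma coordOneForm_eq (α : Π x : M, TangentSpace (𝓡 n) x →L[ℝ] ℝ)
    {x x' : M} {z : EuclideanSpace ℝ (Fin n)} (hz : z ∈ overlap x x')
    (u : EuclideanSpace ℝ (Fin n)) :
    coordOneForm α x z u = coordOneForm α x' (coordChange x x' z)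
      (fderiv ℝ (coordChange x x') z u) := by
  rw [coordOneForm_apply, coordOneForm_apply]
  have := oneForm_congr α (extChartAt_symm_coordChange hz).symm (ofCoord x z u)
  rw [ofCoord_eq hz] at this
  rw [← this, ← ofCoord_eq hz]

lemma coordField_eq (V : Π x : M, TangentSpace (𝓡 n) x)
    {x x' : M} {z : EuclideanSpace ℝ (Fin n)} (hz : z ∈ overlap x x') :
    fderiv ℝ (coordChange x x') z (coordField V x z) = coordField V x' (coordChange x x' z) := by
  refine (isInvertible_ofCoord (mapsTo_coordChange x x' hz)).injective ?_
  have h1 : (V ((extChartAt (𝓡 n) x').symm (coordChange x x' z)) : EuclideanSpace ℝ (Fin n)) =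
      V ((extChartAt (𝓡 n) x).symm z) :=
    congrArg (fun p => (V p : EuclideanSpace ℝ (Fin n))) (extChartAt_symm_coordChange hz)
  rw [ofCoord_coordField V (mapsTo_coordChange x x' hz)]
  refine Eq.trans ?_ h1.symm
  rw [← ofCoord_coordField V hz.1]
  exact (ofCoord_eq hz _).symm

/-- A coordinate change is an isometry between the coordinate expressions of the metric. -/
lemma LorentzianMetric.isIsometryOn_coordChange (g : LorentzianMetric n M) (x x' : M) :
    CoordGeom.IsIsometryOn (coordChange x x') (coordForm g.inner x) (overlap x x')
      (coordForm g.inner x') (extChartAt (𝓡 n) x').target where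
  source :=
    { isOpen := isOpen_overlap x x'
      smooth := (g.isMetricOn_coordForm x).smooth.mono Set.inter_subset_left
      symm := fun y hy => (g.isMetricOn_coordForm x).symm y hy.1
      invertible := fun y hy => (g.isMetricOn_coordForm x).invertible y hy.1 }
  target := g.isMetricOn_coordForm x'
  smooth := contDiffOn_coordChange x x'
  mapsTo := mapsTo_coordChange x x'
  invertible _ hz := isInvertible_fderiv_coordChange hz
  isometry _ hz := coordForm_eq g.inner hz

/-! ### Curvature and derivatives read in a fixed chart -/

lemma CoordGeom.covDeriv_congr {E : Type*} [NormedAddCommGroup E] [NormedSpace ℝ E]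
    (h : E → E →L[ℝ] E →L[ℝ] ℝ) {V W : E → E} {y : E} (hVW : V =ᶠ[nhds y] W) :
    CoordGeom.covDeriv h V y = CoordGeom.covDeriv h W y := by
  rw [CoordGeom.covDeriv, CoordGeom.covDeriv, hVW.fderiv_eq, hVW.eq_of_nhds]

lemma inverse_toCoord_apply (x : M) (v : EuclideanSpace ℝ (Fin n)) :
    (toCoord x).inverse v = v := by
  rw [← toCoord_apply x ((toCoord x).inverse v), (isInvertible_toCoord x).self_apply_inverse]

lemma coordField_eq_self (V : Π x : M, TangentSpace (𝓡 n) x) (x : M) :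
    coordField V x (extChartAt (𝓡 n) x x) = V x := by
  rw [coordField_self, toCoord_apply]

/-- The coordinate frame of the chart at `x`, at a nearby point `p`, is the derivative of the
coordinate change to the preferred chart at `p`. -/
lemma ofCoord_eq_fderiv {x : M} {y : EuclideanSpace ℝ (Fin n)}
    (hy : y ∈ (extChartAt (𝓡 n) x).target) (u : EuclideanSpace ℝ (Fin n)) :
    (ofCoord x y u : EuclideanSpace ℝ (Fin n)) =
      fderiv ℝ (coordChange x ((extChartAt (𝓡 n) x).symm y)) y u := by
  refine (ofCoord_eq (mem_overlap_self hy) u).trans ?_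
  exact congrArg (fun L : EuclideanSpace ℝ (Fin n) →L[ℝ] EuclideanSpace ℝ (Fin n) => L _)
    (ofCoord_self ((extChartAt (𝓡 n) x).symm y))

lemma coordForm_self (β : Π x : M, TangentSpace (𝓡 n) x →L[ℝ] TangentSpace (𝓡 n) x →L[ℝ] ℝ)
    (x : M) (u v : EuclideanSpace ℝ (Fin n)) :
    coordForm β x (extChartAt (𝓡 n) x x) u v = β x u v := by
  rw [coordForm_apply, ofCoord_self]
  exact form_congr β (extChartAt_to_inv x) u v

lemma differentiableAt_coordField_of_smoothFieldOn {V : Π x : M, TangentSpace (𝓡 n) x} {Ω : Set M}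
    (hΩ : IsOpen Ω) (hV : SmoothFieldOn V Ω) {x : M} {y : EuclideanSpace ℝ (Fin n)}
    (hy : y ∈ (extChartAt (𝓡 n) x).target ∩ (extChartAt (𝓡 n) x).symm ⁻¹' Ω) :
    DifferentiableAt ℝ (coordField V x) y :=
  CoordGeom.differentiableAt_of_contDiffOn (isOpen_preimage_extChartAt_symm x hΩ)
    (contDiffOn_coordField hV x) hy

namespace LorentzianMetric

variable (g : LorentzianMetric n M)

lemma leviCivita_eq (Z : Π x : M, TangentSpace (𝓡 n) x) (x : M) :
    g.leviCivita Z x = CoordGeom.covDeriv (coordForm g.inner x) (coordField Z x)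
      (extChartAt (𝓡 n) x x) := by
  ext1 v
  change (toCoord x).inverse (CoordGeom.covDeriv (coordForm g.inner x) (coordField Z x)
      (extChartAt (𝓡 n) x x) (toCoord x v)) = _
  rw [inverse_toCoord_apply, toCoord_apply]
  rfl

lemma ricci_apply (x : M) (v w : TangentSpace (𝓡 n) x) :
    g.ricci x v w = CoordGeom.ricci (coordForm g.inner x) (extChartAt (𝓡 n) x x) v w := by
  change CoordGeom.ricci (coordForm g.inner x) (extChartAt (𝓡 n) x x) (toCoord x v) (toCoord x w)
    = _
  rw [toCoord_apply, toCoord_apply]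

/-- The Levi-Civita connection, computed in the chart at `x`, at a point near `x`. -/
lemma ofCoord_covDeriv {Z : Π x : M, TangentSpace (𝓡 n) x} {Ω : Set M} (hΩ : IsOpen Ω)
    (hZ : SmoothFieldOn Z Ω) {x : M} {y : EuclideanSpace ℝ (Fin n)}
    (hy : y ∈ (extChartAt (𝓡 n) x).target ∩ (extChartAt (𝓡 n) x).symm ⁻¹' Ω)
    (u : EuclideanSpace ℝ (Fin n)) :
    ofCoord x y (CoordGeom.covDeriv (coordForm g.inner x) (coordField Z x) y u) =
      g.leviCivita Z ((extChartAt (𝓡 n) x).symm y) (ofCoord x y u) := by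
  rw [leviCivita_eq]
  refine (ofCoord_eq_fderiv hy.1 _).trans ?_
  refine ((g.isIsometryOn_coordChange x _).covDeriv_eq (mem_overlap_self hy.1)
    (differentiableAt_coordField_of_smoothFieldOn hΩ hZ hy)
    (differentiableAt_coordField_of_smoothFieldOn hΩ hZ (mem_target_of_mem hy.2))
    (fun z hz => coordField_eq Z hz) u).trans ?_
  rw [← ofCoord_eq_fderiv hy.1]
  rfl

/-- The Ricci curvature, computed in the chart at `x`, at a point near `x`. -/
lemma coord_ricci {x : M} {y : EuclideanSpace ℝ (Fin n)}
    (hy : y ∈ (extChartAt (𝓡 n) x).target) (u v : EuclideanSpace ℝ (Fin n)) :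
    CoordGeom.ricci (coordForm g.inner x) y u v =
      g.ricci ((extChartAt (𝓡 n) x).symm y) (ofCoord x y u) (ofCoord x y v) := by
  rw [ricci_apply]
  refine ((g.isIsometryOn_coordChange x _).ricci_eq (mem_overlap_self hy) u v).trans ?_
  rw [← ofCoord_eq_fderiv hy, ← ofCoord_eq_fderiv hy]
  rfl

/-- The scalar curvature, computed in the chart at `x`, at a point near `x`. -/
lemma coord_scalar {x : M} {y : EuclideanSpace ℝ (Fin n)}
    (hy : y ∈ (extChartAt (𝓡 n) x).target) :
    CoordGeom.scalar (coordForm g.inner x) y = g.scalar ((extChartAt (𝓡 n) x).symm y) :=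
  (g.isIsometryOn_coordChange x _).scalar_eq (mem_overlap_self hy)

lemma coordForm_coordField (V : Π x : M, TangentSpace (𝓡 n) x) {x : M}
    {y : EuclideanSpace ℝ (Fin n)} (hy : y ∈ (extChartAt (𝓡 n) x).target)
    (u : EuclideanSpace ℝ (Fin n)) :
    coordForm g.inner x y (coordField V x y) u =
      g.inner ((extChartAt (𝓡 n) x).symm y) (V ((extChartAt (𝓡 n) x).symm y)) (ofCoord x y u) := by
  rw [coordForm_apply, ofCoord_coordField V hy]

lemma coordForm_coordField_coordField (V W : Π x : M, TangentSpace (𝓡 n) x) {x : M}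
    {y : EuclideanSpace ℝ (Fin n)} (hy : y ∈ (extChartAt (𝓡 n) x).target) :
    coordForm g.inner x y (coordField V x y) (coordField W x y) =
      g.inner ((extChartAt (𝓡 n) x).symm y) (V ((extChartAt (𝓡 n) x).symm y))
        (W ((extChartAt (𝓡 n) x).symm y)) := by
  rw [g.coordForm_coordField V hy, ofCoord_coordField W hy]

lemma coordOneForm_flat (V : Π x : M, TangentSpace (𝓡 n) x) {x : M}
    {y : EuclideanSpace ℝ (Fin n)} (hy : y ∈ (extChartAt (𝓡 n) x).target) :
    coordOneForm (g.flat V) x y = coordForm g.inner x y (coordField V x y) := by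
  ext u
  rw [g.coordForm_coordField V hy]
  rfl

lemma contDiffOn_coordOneForm_flat {V : Π x : M, TangentSpace (𝓡 n) x}
    (hV : SmoothFieldOn V Set.univ) (x : M) :
    ContDiffOn ℝ ∞ (coordOneForm (g.flat V) x) (extChartAt (𝓡 n) x).target := by
  have h1 := contDiffOn_coordField hV x
  rw [Set.preimage_univ, Set.inter_univ] at h1
  exact ((g.isMetricOn_coordForm x).smooth.clm_apply h1).congr fun y hy => g.coordOneForm_flat V hy

/-- The exterior derivative of the dual 1-form of a field, in the chart at `x`. -/
lemma coordForm_extDerivOne_flat {V : Π x : M, TangentSpace (𝓡 n) x}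
    (hV : SmoothFieldOn V Set.univ) {x : M} {y : EuclideanSpace ℝ (Fin n)}
    (hy : y ∈ (extChartAt (𝓡 n) x).target) (u v : EuclideanSpace ℝ (Fin n)) :
    coordForm (extDerivOne (g.flat V)) x y u v =
      fderiv ℝ (coordOneForm (g.flat V) x) y u v - fderiv ℝ (coordOneForm (g.flat V) x) y v u := by
  have d : ∀ x y, y ∈ (extChartAt (𝓡 n) x).target →
      DifferentiableAt ℝ (coordOneForm (g.flat V) x) y := fun x y hy =>
    CoordGeom.differentiableAt_of_contDiffOn (isOpen_extChartAt_target x)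
      (g.contDiffOn_coordOneForm_flat hV x) hy
  rw [(g.isIsometryOn_coordChange x ((extChartAt (𝓡 n) x).symm y)).extDeriv_eq
    (mem_overlap_self hy) (d x y hy) (d _ _ (mem_extChartAt_target _))
    (fun z hz => coordOneForm_eq (g.flat V) hz), ← ofCoord_eq_fderiv hy, ← ofCoord_eq_fderiv hy]
  rw [coordForm_apply]
  simp only [extDerivOne, ContinuousLinearMap.comp_apply, ContinuousLinearMap.precomp_apply,
    toCoord_apply]
  rfl

/-- The form `d(V♭)` is closed. -/
lemma extDerivTwo_extDerivOne_flat {V : Π x : M, TangentSpace (𝓡 n) x}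
    (hV : SmoothFieldOn V Set.univ) (x : M) (u v w : TangentSpace (𝓡 n) x) :
    extDerivTwo (extDerivOne (g.flat V)) x u v w = 0 := by
  have hU := isOpen_extChartAt_target (I := 𝓡 n) x
  have hy := mem_extChartAt_target (I := 𝓡 n) x
  set β := coordOneForm (g.flat V) x with hβ
  set F := coordForm (extDerivOne (g.flat V)) x with hF
  have sβ : ContDiffOn ℝ ∞ β _ := g.contDiffOn_coordOneForm_flat hV x
  have sβ' := CoordGeom.contDiffOn_fderiv hU sβ
  have dβ' := CoordGeom.differentiableAt_of_contDiffOn hU sβ' hy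
  have hFβ : ∀ z ∈ (extChartAt (𝓡 n) x).target, F z = fderiv ℝ β z - (fderiv ℝ β z).flip :=
    fun z hz => by
      ext u v
      exact g.coordForm_extDerivOne_flat hV hz u v
  have hc : ∀ u : EuclideanSpace ℝ (Fin n), ContDiffOn ℝ ∞ (fun z => fderiv ℝ β z u) _ :=
    fun u => sβ'.clm_apply contDiffOn_const
  have sF : ContDiffOn ℝ ∞ F (extChartAt (𝓡 n) x).target := by
    refine contDiffOn_clm_apply.2 fun u => contDiffOn_clm_apply.2 fun v => ?_
    refine (((hc u).clm_apply (contDiffOn_const (c := v))).sub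
      ((hc v).clm_apply (contDiffOn_const (c := u)))).congr fun z hz => ?_
    rw [hFβ z hz]; rfl
  have dF := CoordGeom.differentiableAt_of_contDiffOn hU sF hy
  have key : ∀ a u v : EuclideanSpace ℝ (Fin n), fderiv ℝ F (extChartAt (𝓡 n) x x) a u v =
      fderiv ℝ (fderiv ℝ β) (extChartAt (𝓡 n) x x) a u v
        - fderiv ℝ (fderiv ℝ β) (extChartAt (𝓡 n) x x) a v u := by
    intro a u v
    have d1 : ∀ u, DifferentiableAt ℝ (fun z => fderiv ℝ β z u) (extChartAt (𝓡 n) x x) :=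
      fun u => dβ'.clm_apply (differentiableAt_const u)
    have e : ∀ z ∈ (extChartAt (𝓡 n) x).target, F z u v = fderiv ℝ β z u v - fderiv ℝ β z v u :=
      fun z hz => by rw [hFβ z hz]; rfl
    rw [← CoordGeom.fderiv_clm_apply_const dF, ← CoordGeom.fderiv_clm_apply_const
      (dF.clm_apply (differentiableAt_const u)), CoordGeom.fderiv_eq_of_eqOn hU e hy,
      fderiv_fun_sub ((d1 u).clm_apply (differentiableAt_const v))
        ((d1 v).clm_apply (differentiableAt_const u)), sub_apply,
      CoordGeom.fderiv_clm_apply_const (d1 u), CoordGeom.fderiv_clm_apply_const (d1 v),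
      CoordGeom.fderiv_clm_apply_const dβ', CoordGeom.fderiv_clm_apply_const dβ']
  simp only [extDerivTwo, ← hF, key]
  rw [CoordGeom.snd_fderiv_symm hU sβ hy (toCoord x v) (toCoord x u),
    CoordGeom.snd_fderiv_symm hU sβ hy (toCoord x w) (toCoord x u),
    CoordGeom.snd_fderiv_symm hU sβ hy (toCoord x w) (toCoord x v)]
  ring

end LorentzianMetric

end Manifold

/-! ### Charged dust in a Kaluza-Klein spacetime -/

section KaluzaKlein

variable {M : Type*} [TopologicalSpace M] [ChartedSpace (EuclideanSpace ℝ (Fin 5)) M]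
  [IsManifold (𝓡 5) ∞ M]
  {B : Type*} [TopologicalSpace B] [ChartedSpace (EuclideanSpace ℝ (Fin 4)) B]
  [IsManifold (𝓡 4) ∞ B]

namespace KaluzaKleinSpacetime

variable [MulAction Circle M] {K : KaluzaKleinSpacetime M B}
  {Y : Π x : M, TangentSpace (𝓡 5) x}

lemma inner_visibleField_Y (hY : K.IsUnitFiberField Y) (X : Π x : M, TangentSpace (𝓡 5) x) (x : M) :
    K.g.inner x (K.visibleField Y X x) (Y x) = 0 := by
  simp [visibleField, prH, hY.unit]

variable {Ω : Set M} {μ α : M → ℝ} {X : Π x : M, TangentSpace (𝓡 5) x}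

/-- The eigenvalue `-μ` of the horizontal Einstein endomorphism normalizes the visible field. -/
lemma IsChargedDust.inner_visibleField_self (hY : K.IsUnitFiberField Y)
    (hdust : K.IsChargedDust Y Ω μ α X) {x : M} (hx : x ∈ Ω) :
    K.g.inner x (K.visibleField Y X x) (K.visibleField Y X x) = -1 := by
  have h0 := inner_visibleField_Y hY X x
  have h0' := h0
  rw [K.g.symm] at h0'
  have h1 := (hdust.eigenspace x hx (K.visibleField Y X x) h0).2 ⟨1, (one_smul ℝ _).symm⟩
  have h2 := congrArg (fun v => K.g.inner x v (K.visibleField Y X x)) h1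
  have hX : K.g.inner x (X x) (K.visibleField Y X x) =
      K.g.inner x (K.visibleField Y X x) (K.visibleField Y X x) := by
    have h := congrArg (fun v => K.g.inner x v (K.visibleField Y X x))
      (show X x = K.visibleField Y X x + K.g.inner x (X x) (Y x) • Y x by simp [visibleField, prH])
    simpa only [map_add, add_apply, map_smul, smul_apply, h0', smul_zero, add_zero] using h
  have h3 : K.g.inner x (K.g.endo K.g.einstein x (K.visibleField Y X x)) (K.visibleField Y X x) =
      μ x * K.g.inner x (K.visibleField Y X x) (K.visibleField Y X x) ^ 2 := by
    rw [LorentzianMetric.endo, ContinuousLinearMap.comp_apply, K.g.inner_inverse,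
      hdust.einstein_eq x hx, hX, h0']
    ring
  rw [prH] at h2
  simp only [map_sub, map_smul, sub_apply, smul_apply, h0', h3, smul_eq_mul, mul_zero,
    sub_zero] at h2
  have h4 := hdust.timelike x hx
  change K.g.inner x (K.visibleField Y X x) (K.visibleField Y X x) < 0 at h4
  have h5 := hdust.μ_pos x hx
  -- with `q = g(X₀, X₀)`, the eigenvalue equation reads `μ q ^ 2 = -μ q`
  have h6 : μ x * K.g.inner x (K.visibleField Y X x) (K.visibleField Y X x) *
    (K.g.inner x (K.visibleField Y X x) (K.visibleField Y X x) + 1) = 0 := by linarith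
  rcases mul_eq_zero.1 h6 with h | h
  · exact absurd h (mul_ne_zero h5.ne' h4.ne)
  · linarith

/-- `X` is normalized by its horizontal part. -/
lemma IsChargedDust.inner_X_self (hY : K.IsUnitFiberField Y)
    (hdust : K.IsChargedDust Y Ω μ α X) {x : M} (hx : x ∈ Ω) :
    K.g.inner x (X x) (X x) = K.g.inner x (X x) (Y x) ^ 2 - 1 := by
  have h := hdust.inner_visibleField_self hY hx
  simp only [visibleField, prH, map_sub, map_smul, sub_apply, smul_apply, smul_eq_mul, hY.unit,
    K.g.symm x (Y x) (X x)] at h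
  linarith

lemma IsChargedDust.chargeDensity_eq (hY : K.IsUnitFiberField Y)
    (hdust : K.IsChargedDust Y Ω μ α X) {x : M} (hx : x ∈ Ω) :
    K.chargeDensity Y X x = -(μ x * K.g.inner x (X x) (Y x)) := by
  rw [chargeDensity, hdust.einstein_eq x hx]
  simp only [visibleField, prH, map_sub, map_smul, smul_eq_mul, hY.unit,
    K.g.symm x (Y x) (X x), hdust.inner_X_self hY hx]
  ring

lemma IsChargedDust.gammaCoeff_eq (hY : K.IsUnitFiberField Y)
    (hdust : K.IsChargedDust Y Ω μ α X) {x : M} (hx : x ∈ Ω) :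
    K.gammaCoeff Y x = μ x * K.g.inner x (X x) (Y x) ^ 2 + α x := by
  rw [gammaCoeff, hdust.einstein_eq x hx, hY.unit]
  ring

/-- The chart expression of a charged dust domain. The curvature at each point is computed in the
preferred chart of that point, whence the appeal to naturality. -/
lemma IsChargedDust.isDustOn (hY : K.IsUnitFiberField Y) (hKilling : K.g.IsKilling Y)
    (hdust : K.IsChargedDust Y Ω μ α X) (x : M) :
    CoordGeom.IsDustOn (coordForm K.g.inner x)
      ((extChartAt (𝓡 5) x).target ∩ (extChartAt (𝓡 5) x).symm ⁻¹' Ω)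
      (coordField Y x) (coordField X x)
      (fun y => μ ((extChartAt (𝓡 5) x).symm y)) (fun y => α ((extChartAt (𝓡 5) x).symm y)) where
  isOpen := isOpen_preimage_extChartAt_symm x hdust.isOpen
  smooth := (K.g.isMetricOn_coordForm x).smooth.mono Set.inter_subset_left
  symm y hy := (K.g.isMetricOn_coordForm x).symm y hy.1
  invertible y hy := (K.g.isMetricOn_coordForm x).invertible y hy.1
  smooth_Y := (contDiffOn_coordField hY.smooth x).mono
    (Set.inter_subset_inter_right _ (Set.preimage_mono (Set.subset_univ _)))
  smooth_X := contDiffOn_coordField hdust.smooth_X x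
  smooth_μ := contDiffOn_comp_extChartAt_symm hdust.smooth_μ x
  smooth_α := contDiffOn_comp_extChartAt_symm hdust.smooth_α x
  killing y hy u v := by
    rw [coordForm_apply, coordForm_apply, K.g.ofCoord_covDeriv isOpen_univ hY.smooth ⟨hy.1, trivial⟩,
      K.g.ofCoord_covDeriv isOpen_univ hY.smooth ⟨hy.1, trivial⟩]
    exact hKilling _ _ _
  unit_Y y hy := by
    rw [K.g.coordForm_coordField_coordField Y Y hy.1]
    exact hY.unit _
  norm_X y hy := by
    rw [K.g.coordForm_coordField_coordField X X hy.1, K.g.coordForm_coordField_coordField X Y hy.1]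
    exact hdust.inner_X_self hY hy.2
  μ_ne y hy := (hdust.μ_pos _ hy.2).ne'
  einstein y hy v w := by
    rw [K.g.coord_ricci hy.1, K.g.coord_scalar hy.1, K.g.coordForm_coordField X hy.1,
      K.g.coordForm_coordField X hy.1, K.g.coordForm_coordField Y hy.1,
      K.g.coordForm_coordField Y hy.1, coordForm_apply]
    exact hdust.einstein_eq _ hy.2 _ _

/-! ### Dynamics of charged dust in a Kaluza-Klein spacetime -/

lemma IsChargedDust.contMDiffOn_inner_XY (hY : K.IsUnitFiberField Y)
    (hdust : K.IsChargedDust Y Ω μ α X) :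
    ContMDiffOn (𝓡 5) 𝓘(ℝ, ℝ) ∞ (fun x => K.g.inner x (X x) (Y x)) Ω :=
  K.g.contMDiffOn_inner hdust.smooth_X (hY.smooth.mono (Set.subset_univ _))

lemma IsChargedDust.smooth_visibleField (hY : K.IsUnitFiberField Y)
    (hdust : K.IsChargedDust Y Ω μ α X) : SmoothFieldOn (K.visibleField Y X) Ω :=
  ContMDiffOn.sub_section hdust.smooth_X
    ((hdust.contMDiffOn_inner_XY hY).smul_section (hY.smooth.mono (Set.subset_univ _)))

lemma IsChargedDust.eq_visibleField_sub (hY : K.IsUnitFiberField Y)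
    (hdust : K.IsChargedDust Y Ω μ α X) {x : M} (hx : x ∈ Ω) :
    X x = K.visibleField Y X x - (K.chargeDensity Y X x / μ x) • Y x := by
  rw [hdust.chargeDensity_eq hY hx, neg_div, mul_div_cancel_left₀ _ (hdust.μ_pos x hx).ne']
  simp [visibleField, prH]

/-- The Einstein curvature in terms of the visible field. -/
lemma IsChargedDust.einstein_visibleField (hY : K.IsUnitFiberField Y)
    (hdust : K.IsChargedDust Y Ω μ α X) {x : M} (hx : x ∈ Ω) (v w : TangentSpace (𝓡 5) x) :
    K.g.einstein x v w =
      μ x * (K.g.inner x (K.visibleField Y X x) v * K.g.inner x (K.visibleField Y X x) w)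
        - K.chargeDensity Y X x * (K.g.inner x (K.visibleField Y X x) v * K.g.inner x (Y x) w
            + K.g.inner x (Y x) v * K.g.inner x (K.visibleField Y X x) w)
        + K.gammaCoeff Y x * (K.g.inner x (Y x) v * K.g.inner x (Y x) w) := by
  rw [hdust.einstein_eq x hx, hdust.chargeDensity_eq hY hx, hdust.gammaCoeff_eq hY hx]
  simp only [visibleField, prH, map_sub, map_smul, sub_apply, smul_apply, smul_eq_mul]
  ring

lemma coordForm_inner_self (V W : Π x : M, TangentSpace (𝓡 5) x) (x : M) :
    coordForm K.g.inner x (extChartAt (𝓡 5) x x) (coordField V x (extChartAt (𝓡 5) x x))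
      (coordField W x (extChartAt (𝓡 5) x x)) = K.g.inner x (V x) (W x) := by
  rw [coordForm_self, coordField_eq_self V x, coordField_eq_self W x]

lemma coordField_visibleField (Y X : Π x : M, TangentSpace (𝓡 5) x) {x : M}
    {y : EuclideanSpace ℝ (Fin 5)} (hy : y ∈ (extChartAt (𝓡 5) x).target) :
    coordField (K.visibleField Y X) x y = coordField X x y
      - coordForm K.g.inner x y (coordField X x y) (coordField Y x y) • coordField Y x y := by
  rw [K.g.coordForm_coordField_coordField X Y hy, ← coordField_smul (fun z => K.g.inner z (X z) (Y z))]
  exact (ofCoord x y).inverse.map_sub _ _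

/-- The visible field at `x`, in the chart at `x`. -/
lemma visibleField_eq (Y X : Π x : M, TangentSpace (𝓡 5) x) (x : M) :
    (K.visibleField Y X x : EuclideanSpace ℝ (Fin 5)) =
      coordField X x (extChartAt (𝓡 5) x x) - coordForm K.g.inner x (extChartAt (𝓡 5) x x)
        (coordField X x (extChartAt (𝓡 5) x x)) (coordField Y x (extChartAt (𝓡 5) x x))
          • coordField Y x (extChartAt (𝓡 5) x x) := by
  rw [← coordField_visibleField Y X (mem_extChartAt_target x), coordField_eq_self]

/-- The electromagnetic field is `2 g(∇Y, ·)`. -/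
lemma coordForm_emField (hY : K.IsUnitFiberField Y) (hKilling : K.g.IsKilling Y)
    (hdust : K.IsChargedDust Y Ω μ α X) {x : M} {y : EuclideanSpace ℝ (Fin 5)}
    (hy : y ∈ (extChartAt (𝓡 5) x).target ∩ (extChartAt (𝓡 5) x).symm ⁻¹' Ω)
    (u v : EuclideanSpace ℝ (Fin 5)) :
    coordForm (K.emField Y) x y u v = 2 * coordForm K.g.inner x y
      (CoordGeom.covDeriv (coordForm K.g.inner x) (coordField Y x) y u) v := by
  have D := hdust.isDustOn hY hKilling x
  rw [← D.extDeriv_killing D.smooth_Y D.killing hy u v,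
    ← CoordGeom.fderiv_eq_of_eqOn D.isOpen (fun z hz => K.g.coordOneForm_flat Y hz.1) hy]
  exact K.g.coordForm_extDerivOne_flat hY.smooth hy.1 u v

lemma IsChargedDust.div_mass (hY : K.IsUnitFiberField Y) (hKilling : K.g.IsKilling Y)
    (hdust : K.IsChargedDust Y Ω μ α X) {x : M} (hx : x ∈ Ω) :
    K.g.divergence (fun y => μ y • K.visibleField Y X y) x = 0 := by
  have D := hdust.isDustOn hY hKilling x
  rw [← D.div_mass (mem_target_of_mem hx), LorentzianMetric.divergence, K.g.leviCivita_eq,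
    CoordGeom.covDeriv_congr (coordForm K.g.inner x) (Filter.eventuallyEq_of_mem
      (D.isOpen.mem_nhds (mem_target_of_mem hx)) fun y hy => ?_)]
  · rfl
  · rw [coordField_smul, coordField_visibleField Y X hy.1]

lemma IsChargedDust.div_charge (hY : K.IsUnitFiberField Y) (hKilling : K.g.IsKilling Y)
    (hdust : K.IsChargedDust Y Ω μ α X) {x : M} (hx : x ∈ Ω) :
    K.g.divergence (fun y => K.chargeDensity Y X y • K.visibleField Y X y) x = 0 := by
  have D := hdust.isDustOn hY hKilling x
  rw [← D.div_charge (mem_target_of_mem hx), LorentzianMetric.divergence, K.g.leviCivita_eq,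
    CoordGeom.covDeriv_congr (coordForm K.g.inner x) (Filter.eventuallyEq_of_mem
      (D.isOpen.mem_nhds (mem_target_of_mem hx)) fun y hy => ?_)]
  · rfl
  · rw [coordField_smul, coordField_visibleField Y X hy.1, hdust.chargeDensity_eq hY hy.2,
      K.g.coordForm_coordField_coordField X Y hy.1]

lemma IsChargedDust.mvfderiv_charge_div_mass (hY : K.IsUnitFiberField Y)
    (hKilling : K.g.IsKilling Y) (hdust : K.IsChargedDust Y Ω μ α X) {x : M} (hx : x ∈ Ω) :
    mvfderiv (𝓡 5) (fun y => K.chargeDensity Y X y / μ y) x (K.visibleField Y X x) = 0 := by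
  have D := hdust.isDustOn hY hKilling x
  have h1 : ∀ y ∈ Ω, K.chargeDensity Y X y / μ y = - K.g.inner y (X y) (Y y) := fun y hy => by
    rw [hdust.chargeDensity_eq hY hy, neg_div, mul_div_cancel_left₀ _ (hdust.μ_pos y hy).ne']
  have h2 : ContMDiffOn (𝓡 5) 𝓘(ℝ, ℝ) ∞ (fun y => K.chargeDensity Y X y / μ y) Ω :=
    ((hdust.contMDiffOn_inner_XY hY).neg).congr h1
  have h3 : MDifferentiableAt (𝓡 5) 𝓘(ℝ, ℝ) (fun y => K.chargeDensity Y X y / μ y) x :=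
    (h2.contMDiffAt (hdust.isOpen.mem_nhds hx)).mdifferentiableAt (by simp)
  rw [← (fderiv_comp_extChartAt_symm h3).2, toCoord_apply, visibleField_eq,
    CoordGeom.fderiv_eq_of_eqOn D.isOpen (f' := fun y => - coordForm K.g.inner x y
      (coordField X x y) (coordField Y x y)) (fun y hy => ?_) (mem_target_of_mem hx),
    fderiv_fun_neg, neg_apply, D.fderiv_inner_XY_visible (mem_target_of_mem hx), neg_zero]
  rw [h1 _ hy.2, K.g.coordForm_coordField_coordField X Y hy.1]

/-- The source equation of the electromagnetic field. -/
lemma IsChargedDust.sharp_divForm_emField (hY : K.IsUnitFiberField Y) (hKilling : K.g.IsKilling Y)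
    (hdust : K.IsChargedDust Y Ω μ α X) {x : M} (hx : x ∈ Ω) :
    K.g.sharp x (K.g.divForm (K.emField Y) x) = (2 * K.chargeDensity Y X x) • K.visibleField Y X x
      - (2 * K.gammaCoeff Y x + K.g.scalar x) • Y x := by
  have D := hdust.isDustOn hY hKilling x
  refine K.g.ext_inner fun w => ?_
  -- the claim is `-2 Ric(Y, ·)` with `Ric = G + S g / 2`
  have h1 : K.g.divForm (K.emField Y) x w = -2 * K.g.ricci x (Y x) w := by
    rw [K.g.ricci_apply]
    refine (D.divForm_killing D.smooth_Y D.killing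
      (fun y hy => coordForm_emField hY hKilling hdust hy) (mem_target_of_mem hx) _).trans ?_
    exact congrArg₂ (fun a b : EuclideanSpace ℝ (Fin 5) =>
      -2 * CoordGeom.ricci (coordForm K.g.inner x) (extChartAt (𝓡 5) x x) a b)
      (coordField_eq_self Y x) (toCoord_apply x w)
  have h2 := hdust.einstein_visibleField hY hx (Y x) w
  rw [inner_visibleField_Y hY, hY.unit, LorentzianMetric.einstein] at h2
  simp only [sub_apply, smul_apply, smul_eq_mul] at h2
  rw [LorentzianMetric.sharp, K.g.inner_inverse, h1]
  simp only [map_sub, map_smul, sub_apply, smul_apply, smul_eq_mul]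
  linarith

lemma IsChargedDust.geodesic (hY : K.IsUnitFiberField Y) (hKilling : K.g.IsKilling Y)
    (hdust : K.IsChargedDust Y Ω μ α X) {x : M} (hx : x ∈ Ω) : K.g.nabla X X x = 0 := by
  have h := ((hdust.isDustOn hY hKilling x).dynamics (mem_target_of_mem hx)).2.2.2.2.2
  rw [LorentzianMetric.nabla, K.g.leviCivita_eq]
  rw [coordField_eq_self X x] at h
  exact h

/-- The acceleration of the visible field. -/
lemma IsChargedDust.nabla_visibleField (hY : K.IsUnitFiberField Y) (hKilling : K.g.IsKilling Y)
    (hdust : K.IsChargedDust Y Ω μ α X) {x : M} (hx : x ∈ Ω) :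
    K.g.nabla (K.visibleField Y X) (K.visibleField Y X) x =
      (-2 * K.g.inner x (X x) (Y x)) • K.g.leviCivita Y x (X x) := by
  have D := hdust.isDustOn hY hKilling x
  have h := D.covDeriv_visible_self (mem_target_of_mem hx)
  rw [← visibleField_eq, coordForm_inner_self] at h
  rw [LorentzianMetric.nabla, K.g.leviCivita_eq, K.g.leviCivita_eq,
    CoordGeom.covDeriv_congr (coordForm K.g.inner x) (Filter.eventuallyEq_of_mem
      (D.isOpen.mem_nhds (mem_target_of_mem hx))
        fun y hy => coordField_visibleField Y X hy.1)]
  rw [coordField_eq_self X x] at h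
  exact h

/-- The fibres are geodesics. -/
lemma IsChargedDust.leviCivita_fiber (hY : K.IsUnitFiberField Y) (hKilling : K.g.IsKilling Y)
    (hdust : K.IsChargedDust Y Ω μ α X) {x : M} (hx : x ∈ Ω) :
    K.g.leviCivita Y x (Y x) = 0 := by
  have h := (hdust.isDustOn hY hKilling x).covDeriv_killing_self (mem_target_of_mem hx)
  rw [coordField_eq_self Y x] at h
  rw [K.g.leviCivita_eq]
  exact h

/-- The endomorphism of the electromagnetic field is `2 ∇Y`; the vertical part of `X` does not
contribute because the fibres are geodesics. -/
lemma IsChargedDust.endo_emField_visibleField (hY : K.IsUnitFiberField Y)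
    (hKilling : K.g.IsKilling Y) (hdust : K.IsChargedDust Y Ω μ α X) {x : M} (hx : x ∈ Ω) :
    K.g.endo (K.emField Y) x (K.visibleField Y X x) = (2 : ℝ) • K.g.leviCivita Y x (X x) := by
  have h0 : K.g.leviCivita Y x (K.visibleField Y X x) = K.g.leviCivita Y x (X x) := by
    rw [visibleField, prH, map_sub, map_smul, hdust.leviCivita_fiber hY hKilling hx, smul_zero,
      sub_zero]
  refine K.g.ext_inner fun w => ?_
  rw [← h0, LorentzianMetric.endo, ContinuousLinearMap.comp_apply, K.g.inner_inverse, map_smul,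
    smul_apply, smul_eq_mul, K.g.leviCivita_eq]
  refine (coordForm_self _ x _ _).symm.trans
    ((coordForm_emField hY hKilling hdust (mem_target_of_mem hx) _ w).trans ?_)
  exact congrArg (fun r : ℝ => 2 * r) (coordForm_self K.g.inner x _ _)

/-- The acceleration of the visible field is horizontal. -/
lemma IsChargedDust.inner_nabla_visibleField (hY : K.IsUnitFiberField Y)
    (hKilling : K.g.IsKilling Y) (hdust : K.IsChargedDust Y Ω μ α X) {x : M} (hx : x ∈ Ω) :
    K.g.inner x (K.g.nabla (K.visibleField Y X) (K.visibleField Y X) x) (Y x) = 0 := by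
  -- `g(∇_X Y, Y) = -g(X, ∇_Y Y) = 0`
  have h := hKilling x (X x) (Y x)
  rw [hdust.leviCivita_fiber hY hKilling hx, map_zero, add_zero] at h
  rw [hdust.nabla_visibleField hY hKilling hx, map_smul, smul_apply, h, smul_zero]

end KaluzaKleinSpacetime

end KaluzaKlein

end

theorem mainTheorem1
    {M : Type*} [TopologicalSpace M] [T2Space M] [SecondCountableTopology M]
    [ChartedSpace (EuclideanSpace ℝ (Fin 5)) M] [IsManifold (𝓡 5) ∞ M]
    {B : Type*} [TopologicalSpace B] [T2Space B] [SecondCountableTopology B]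
    [ChartedSpace (EuclideanSpace ℝ (Fin 4)) B] [IsManifold (𝓡 4) ∞ B]
    [MulAction Circle M] (K : KaluzaKleinSpacetime M B)
    (Y : Π x : M, TangentSpace (𝓡 5) x) (hY : K.IsUnitFiberField Y) (hKilling : K.g.IsKilling Y)
    (Ω : Set M) (μ α : M → ℝ) (X : Π x : M, TangentSpace (𝓡 5) x)
    (hdust : K.IsChargedDust Y Ω μ α X) :
    let X₀ := K.visibleField Y X
    let e := K.chargeDensity Y X
    let γ := K.gammaCoeff Y
    let F := K.emField Y
    -- the associated classical data
    (SmoothFieldOn X₀ Ω ∧ ContMDiffOn (𝓡 5) 𝓘(ℝ, ℝ) ∞ e Ω ∧ ContMDiffOn (𝓡 5) 𝓘(ℝ, ℝ) ∞ γ Ω ∧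
      ∀ x ∈ Ω, K.g.inner x (X₀ x) (X₀ x) = -1 ∧ K.g.inner x (X₀ x) (Y x) = 0 ∧
        X x = X₀ x - (e x / μ x) • Y x ∧
        ∀ v w, K.g.einstein x v w =
          μ x * (K.g.inner x (X₀ x) v * K.g.inner x (X₀ x) w)
            - e x * (K.g.inner x (X₀ x) v * K.g.inner x (Y x) w
                + K.g.inner x (Y x) v * K.g.inner x (X₀ x) w)
            + γ x * (K.g.inner x (Y x) v * K.g.inner x (Y x) w)) ∧
    -- conservation laws
    (∀ x ∈ Ω, K.g.divergence (fun y => μ y • X₀ y) x = 0 ∧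
      K.g.divergence (fun y => e y • X₀ y) x = 0 ∧
      mvfderiv (𝓡 5) (fun y => e y / μ y) x (X₀ x) = 0) ∧
    -- Maxwell equations
    (∀ x u v w, extDerivTwo F x u v w = 0) ∧
    (∀ x ∈ Ω, K.g.sharp x (K.g.divForm F x) =
      (2 * e x) • X₀ x - (2 * γ x + K.g.scalar x) • Y x) ∧
    -- free fall
    (∀ x ∈ Ω, K.g.nabla X X x = 0) ∧
    -- Lorentz law
    (∀ x ∈ Ω, μ x • K.g.nabla X₀ X₀ x = e x • K.g.endo F x (X₀ x) ∧
      K.g.inner x (K.g.nabla X₀ X₀ x) (Y x) = 0) := by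
  intro X₀ e γ F
  have sa := hdust.contMDiffOn_inner_XY hY
  refine ⟨⟨hdust.smooth_visibleField hY, ?_, ?_, fun x hx => ⟨hdust.inner_visibleField_self hY hx,
      KaluzaKleinSpacetime.inner_visibleField_Y hY X x, hdust.eq_visibleField_sub hY hx,
      hdust.einstein_visibleField hY hx⟩⟩,
    fun x hx => ⟨hdust.div_mass hY hKilling hx, hdust.div_charge hY hKilling hx,
      hdust.mvfderiv_charge_div_mass hY hKilling hx⟩,
    K.g.extDerivTwo_extDerivOne_flat hY.smooth,
    fun x hx => hdust.sharp_divForm_emField hY hKilling hx,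
    fun x hx => hdust.geodesic hY hKilling hx,
    fun x hx => ⟨?_, hdust.inner_nabla_visibleField hY hKilling hx⟩⟩
  · exact ((hdust.smooth_μ.mul sa).neg).congr fun x hx => hdust.chargeDensity_eq hY hx
  · exact ((hdust.smooth_μ.mul (sa.pow 2)).add hdust.smooth_α).congr
      fun x hx => hdust.gammaCoeff_eq hY hx
  · rw [hdust.nabla_visibleField hY hKilling hx, hdust.endo_emField_visibleField hY hKilling hx,
      show e x = _ from hdust.chargeDensity_eq hY hx, smul_smul, smul_smul]
    congr 1
    ring
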